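/- Let $I=[0,1]$, let $g:\mathbb R\to[0,\infty)$ be a continuous, even probability density that is monotonically decreasing (not necessarily strictly) on $(0,\infty)$, and let $W:I^2\to\mathbb R$ be symmetric and square-integrable. Let $\mathcal W[f](x)=\int_I W(x,y)f(y)\,dy$ be the kernel operator on the complex space $L^2(I)$. On the complex space $L^2(\mathbb R\times I,\ g(\omega)\,d\omega\,dx)$ let $$\mathcal P[z](\omega,x)=\int_I\int_{\mathbb R}W(x,y)\,z(\lambda,y)\,g(\lambda)\,d\lambda\,dy,$$ and for $K\in\mathbb R$ let $T[z]=i\omega z+\tfrac K2\,\mathcal P[z]$, with domain the set of all $z$ in this space for which $\omega z$ is also in it. ($T$ governs the first Fourier mode in the linearization of the mean field Kuramoto equation on the graphon $W$ about the incoherent state.) If $\mathcal W$ has positive eigenvalues, then it has a largest one, $\zeta_{\max}(\mathcal W)$; if it has negative eigenvalues, then it has a smallest one, $\zeta_{\min}(\mathcal W)$. Put $$K_c^+=\frac{2}{\pi g(0)\,\zeta_{\max}(\mathcal W)},\qquad K_c^-=\frac{2}{\pi g(0)\,\zeta_{\min}(\mathcal W)},$$ where $K_c^+:=+\infty$ if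 $\mathcal W$ has no positive eigenvalue and $K_c^-:=-\infty$ if $\mathcal W$ has no negative eigenvalue. Then for every $K\in\mathbb R$ the operator $T$ is closed, its residual spectrum is empty, and its continuous spectrum (the points $\lambda$ of the spectrum for which $T-\lambda$ is injective with dense range) is $\sigma_c(T)=i\,\mathrm{supp}(g)$. Moreover: 1. if $K_c^-\le K\le K_c^+$, then the spectrum of $T$ is the union of the continuous spectrum $i\,\mathrm{supp}(g)$ and the set of eigenvalues of $T$, and every eigenvalue of $T$ (there may be none) is a negative real number; 2. otherwise, $T$ has at least one positive real eigenvalue. -/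

import Mathlib

open MeasureTheory Set
open scoped ENNReal unitInterval

noncomputable section

namespace KMGraph

/-! ### Spectra of (unbounded) linear operators on a complex normed space -/

section Spectrum

variable {E : Type*} [NormedAddCommGroup E] [NormedSpace ℂ E]

/-- The operator `A - z`, with the same domain as `A`. -/
def shift (A : E →ₗ.[ℂ] E) (z : ℂ) : A.domain →ₗ[ℂ] E :=
  A.toFun - z • A.domain.subtype

/-- The resolvent set: `A - z` is a bijection from the domain onto the whole space,
with bounded inverse. -/
def resolventSet (A : E →ₗ.[ℂ] E) : Set ℂ :=
  {z | Function.Bijective (shift A z) ∧ ∃ C : ℝ, ∀ v : A.domain, ‖(v : E)‖ ≤ C * ‖shift A z v‖}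

/-- The spectrum: the complement of the resolvent set. -/
def fullSpectrum (A : E →ₗ.[ℂ] E) : Set ℂ := (resolventSet A)ᶜ

/-- The point spectrum: the set of eigenvalues. -/
def pointSpectrum (A : E →ₗ.[ℂ] E) : Set ℂ :=
  {z | ∃ v : A.domain, (v : E) ≠ 0 ∧ A v = z • (v : E)}

/-- The continuous spectrum: points of the spectrum at which `A - z` is injective with dense
range. -/
def continuousSpectrum (A : E →ₗ.[ℂ] E) : Set ℂ :=
  {z | z ∈ fullSpectrum A ∧ Function.Injective (shift A z) ∧ DenseRange (shift A z)}

/-- The residual spectrum: `A - z` is injective and its range is not dense. -/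
def residualSpectrum (A : E →ₗ.[ℂ] E) : Set ℂ :=
  {z | Function.Injective (shift A z) ∧ ¬ DenseRange (shift A z)}

end Spectrum

/-! ### Integral operators with square-integrable kernels -/

section Kernel

variable {α : Type*} [MeasurableSpace α] {μ : Measure α} [SFinite μ]

theorem kernel_section_memLp {k : α → α → ℂ}
    (hk : MemLp (Function.uncurry k) 2 (μ.prod μ)) : ∀ᵐ x ∂μ, MemLp (k x) 2 μ := by
  have h1 := (memLp_two_iff_integrable_sq_norm hk.1).1 hk
  filter_upwards [h1.prod_right_ae, hk.1.prodMk_left] with x hx hx'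
  exact (memLp_two_iff_integrable_sq_norm hx').2 hx

theorem kernel_integrable {k : α → α → ℂ} (hk : MemLp (Function.uncurry k) 2 (μ.prod μ))
    (f : Lp ℂ 2 μ) : ∀ᵐ x ∂μ, Integrable (fun y => k x y * f y) μ := by
  filter_upwards [kernel_section_memLp hk] with x hx
  exact MemLp.integrable_mul hx (Lp.memLp f)

theorem kernel_memLp {k : α → α → ℂ} (hk : MemLp (Function.uncurry k) 2 (μ.prod μ))
    (f : Lp ℂ 2 μ) : MemLp (fun x => ∫ y, k x y * f y ∂μ) 2 μ := by
  have hf := Lp.memLp f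
  have hm : AEStronglyMeasurable (fun x => ∫ y, k x y * f y ∂μ) μ :=
    AEStronglyMeasurable.integral_prod_right' (f := fun q : α × α => k q.1 q.2 * f q.2)
      (hk.1.mul hf.1.comp_snd)
  refine ⟨hm, ?_⟩
  have hk2 : ∫⁻ q, ‖Function.uncurry k q‖ₑ ^ (2 : ℝ) ∂(μ.prod μ) < ⊤ := by
    simpa using lintegral_rpow_enorm_lt_top_of_eLpNorm_lt_top (by simp) (by simp) hk.2
  have hf2 : ∫⁻ y, ‖f y‖ₑ ^ (2 : ℝ) ∂μ < ⊤ := by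
    simpa using lintegral_rpow_enorm_lt_top_of_eLpNorm_lt_top (by simp) (by simp) hf.2
  rw [eLpNorm_lt_top_iff_lintegral_rpow_enorm_lt_top (by simp) (by simp)]
  simp only [ENNReal.toReal_ofNat]
  rw [lintegral_prod _ (hk.1.enorm.pow_const _)] at hk2
  calc ∫⁻ x, ‖∫ y, k x y * f y ∂μ‖ₑ ^ (2 : ℝ) ∂μ
      ≤ ∫⁻ x, (∫⁻ y, ‖k x y‖ₑ ^ (2 : ℝ) ∂μ) * (∫⁻ y, ‖f y‖ₑ ^ (2 : ℝ) ∂μ) ∂μ := by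
        refine lintegral_mono_ae ?_
        filter_upwards [kernel_section_memLp hk] with x hx
        have h1 : ‖∫ y, k x y * f y ∂μ‖ₑ ≤
            (∫⁻ y, ‖k x y‖ₑ ^ (2 : ℝ) ∂μ) ^ (1 / (2 : ℝ)) *
              (∫⁻ y, ‖f y‖ₑ ^ (2 : ℝ) ∂μ) ^ (1 / (2 : ℝ)) := by
          refine (enorm_integral_le_lintegral_enorm _).trans ?_
          simp only [enorm_mul]
          exact ENNReal.lintegral_mul_le_Lp_mul_Lq μ Real.HolderConjugate.two_two
            hx.1.enorm hf.1.enorm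
        refine (ENNReal.rpow_le_rpow h1 (by norm_num)).trans ?_
        rw [ENNReal.mul_rpow_of_nonneg _ _ (by norm_num), ← ENNReal.rpow_mul, ← ENNReal.rpow_mul]
        norm_num
    _ = (∫⁻ x, (∫⁻ y, ‖k x y‖ₑ ^ (2 : ℝ) ∂μ) ∂μ) * (∫⁻ y, ‖f y‖ₑ ^ (2 : ℝ) ∂μ) :=
        lintegral_mul_const' _ _ hf2.ne
    _ < ⊤ := ENNReal.mul_lt_top hk2 hf2

/-- The integral operator `f ↦ ∫ k(·, y) f(y) dμ(y)` on `L²(μ)`, for `k ∈ L²(μ × μ)`. -/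
def kernelOp (k : α → α → ℂ) (hk : MemLp (Function.uncurry k) 2 (μ.prod μ)) :
    Lp ℂ 2 μ →ₗ[ℂ] Lp ℂ 2 μ where
  toFun f := (kernel_memLp hk f).toLp
  map_add' f h := by
    rw [← MemLp.toLp_add]
    refine MemLp.toLp_congr _ _ ?_
    filter_upwards [kernel_integrable hk f, kernel_integrable hk h] with x h1 h2
    simp only [Pi.add_apply]
    rw [← integral_add h1 h2]
    refine integral_congr_ae ?_
    filter_upwards [Lp.coeFn_add f h] with y hy
    rw [hy, Pi.add_apply, mul_add]
  map_smul' c f := by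
    rw [RingHom.id_apply, ← MemLp.toLp_const_smul]
    refine MemLp.toLp_congr _ _ (Filter.Eventually.of_forall fun x => ?_)
    simp only [Pi.smul_apply]
    rw [← integral_smul]
    refine integral_congr_ae ?_
    filter_upwards [Lp.coeFn_smul c f] with y hy
    rw [hy, Pi.smul_apply, smul_eq_mul, smul_eq_mul, mul_left_comm]

end Kernel

/-! ### Graphons and frequency densities -/

/-- A graphon: a symmetric, square-integrable real function on the unit square. -/
structure Graphon where
  kernel : I → I → ℝ
  symm : ∀ x y, kernel x y = kernel y x
  memLp : MemLp (Function.uncurry kernel) 2 (volume.prod volume)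

/-- A continuous even probability density on `ℝ` that is monotonically decreasing (not
necessarily strictly) on the positive half-line. -/
structure FreqDensity where
  dens : ℝ → ℝ
  continuous : Continuous dens
  nonneg : ∀ ω, 0 ≤ dens ω
  integral_eq_one : ∫ ω, dens ω = 1
  even : ∀ ω, dens (-ω) = dens ω
  antitoneOn : AntitoneOn dens (Ioi 0)

/-- The probability measure `g(ω) dω` on `ℝ`. -/
def FreqDensity.measure (g : FreqDensity) : Measure ℝ :=
  volume.withDensity fun ω => ENNReal.ofReal (g.dens ω)

instance FreqDensity.isProbabilityMeasure (g : FreqDensity) : IsProbabilityMeasure g.measure := by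
  have hi : Integrable g.dens := by
    by_contra h
    exact zero_ne_one ((integral_undef h).symm.trans g.integral_eq_one)
  constructor
  rw [FreqDensity.measure, withDensity_apply _ MeasurableSet.univ, Measure.restrict_univ,
    ← ofReal_integral_eq_lintegral_ofReal hi (Filter.Eventually.of_forall g.nonneg),
    g.integral_eq_one, ENNReal.ofReal_one]

/-- The measure `g(ω) dω dx` on `X = ℝ × I`. -/
abbrev FreqDensity.measureX (g : FreqDensity) : Measure (ℝ × I) := g.measure.prod volume

/-- The weighted Lebesgue space `L²(X, g dω dx)` of complex functions, `X = ℝ × I`. -/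
abbrev L2X (g : FreqDensity) : Type := Lp ℂ 2 g.measureX

theorem Graphon.memLp_complex (W : Graphon) :
    MemLp (Function.uncurry fun x y => (W.kernel x y : ℂ)) 2
      ((volume : Measure I).prod (volume : Measure I)) :=
  W.memLp.ofReal

theorem Graphon.memLp_X (W : Graphon) (g : FreqDensity) :
    MemLp (Function.uncurry fun p q : ℝ × I => (W.kernel p.2 q.2 : ℂ)) 2
      (g.measureX.prod g.measureX) := by
  have hs : MeasurePreserving (Prod.snd : ℝ × I → I) g.measureX volume := measurePreserving_snd
  exact W.memLp_complex.comp_measurePreserving (hs.prod hs)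

/-! ### The operators -/

/-- The kernel operator `𝒲[f](x) = ∫_I W(x, y) f(y) dy` on `L²(I)`. -/
def Graphon.op (W : Graphon) : Lp ℂ 2 (volume : Measure I) →ₗ[ℂ] Lp ℂ 2 (volume : Measure I) :=
  kernelOp (fun x y => (W.kernel x y : ℂ)) W.memLp_complex

/-- The operator `𝒫[z](ω, x) = ∫_I ∫_ℝ W(x, y) z(λ, y) g(λ) dλ dy` on `L²(X, g dω dx)`. -/
def opP (g : FreqDensity) (W : Graphon) : L2X g →ₗ[ℂ] L2X g :=
  kernelOp (fun p q => (W.kernel p.2 q.2 : ℂ)) (W.memLp_X g)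

/-- The domain of multiplication by `iω`: all `z ∈ L²(X, g dω dx)` with
`iω z ∈ L²(X, g dω dx)`. -/
def mulDomain (g : FreqDensity) : Submodule ℂ (L2X g) where
  carrier := {z | MemLp (fun p => Complex.I * (p.1 : ℂ) * z p) 2 g.measureX}
  add_mem' := by
    intro a b ha hb
    refine (MemLp.add ha hb).ae_eq ?_
    filter_upwards [Lp.coeFn_add a b] with p hp
    rw [hp, Pi.add_apply, Pi.add_apply, mul_add]
  zero_mem' := by
    refine (MemLp.zero (ε := ℂ)).ae_eq ?_
    filter_upwards [Lp.coeFn_zero ℂ 2 g.measureX] with p hp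
    rw [hp, Pi.zero_apply, mul_zero]
  smul_mem' := by
    intro c a ha
    refine (MemLp.const_smul ha c).ae_eq ?_
    filter_upwards [Lp.coeFn_smul c a] with p hp
    rw [hp, Pi.smul_apply, Pi.smul_apply, smul_eq_mul, smul_eq_mul, mul_left_comm]

theorem memLp_of_mem_mulDomain {g : FreqDensity} {z : L2X g} (hz : z ∈ mulDomain g) :
    MemLp (fun p => Complex.I * (p.1 : ℂ) * z p) 2 g.measureX := hz

/-- Multiplication by `iω` on its maximal domain in `L²(X, g dω dx)`. -/
def mulOp (g : FreqDensity) : L2X g →ₗ.[ℂ] L2X g where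
  domain := mulDomain g
  toFun :=
    { toFun := fun z => (memLp_of_mem_mulDomain z.2).toLp
      map_add' := by
        intro a b
        rw [← MemLp.toLp_add]
        refine MemLp.toLp_congr _ _ ?_
        filter_upwards [Lp.coeFn_add (a : L2X g) (b : L2X g)] with p hp
        rw [Submodule.coe_add, hp, Pi.add_apply, Pi.add_apply, mul_add]
      map_smul' := by
        intro c a
        rw [RingHom.id_apply, ← MemLp.toLp_const_smul]
        refine MemLp.toLp_congr _ _ ?_
        filter_upwards [Lp.coeFn_smul c (a : L2X g)] with p hp
        rw [Submodule.coe_smul, hp, Pi.smul_apply, Pi.smul_apply, smul_eq_mul, smul_eq_mul,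
          mul_left_comm] }

/-- The linearization of the first Fourier mode, `T[z] = iω z + (K/2) 𝒫[z]`, on the maximal domain
of the multiplication by `iω`. -/
def opT (g : FreqDensity) (W : Graphon) (K : ℝ) : L2X g →ₗ.[ℂ] L2X g where
  domain := (mulOp g).domain
  toFun := (mulOp g).toFun + ((K : ℂ) / 2) • (opP g W ∘ₗ (mulOp g).domain.subtype)

/-! ### Extreme eigenvalues of `𝒲` and the transition points -/

/-- The positive eigenvalues of `𝒲`. -/
def Graphon.posEigs (W : Graphon) : Set ℝ :=
  {ζ | 0 < ζ ∧ Module.End.HasEigenvalue W.op (ζ : ℂ)}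

/-- The negative eigenvalues of `𝒲`. -/
def Graphon.negEigs (W : Graphon) : Set ℝ :=
  {ζ | ζ < 0 ∧ Module.End.HasEigenvalue W.op (ζ : ℂ)}

/-- The largest positive eigenvalue of `𝒲` (meaningful if there is a positive eigenvalue). -/
def Graphon.zetaMax (W : Graphon) : ℝ := sSup W.posEigs

/-- The smallest negative eigenvalue of `𝒲` (meaningful if there is a negative eigenvalue). -/
def Graphon.zetaMin (W : Graphon) : ℝ := sInf W.negEigs

open Classical in
/-- `K_c⁺ = 2 / (π g(0) ζ_max(𝒲))`, which is `+∞` if `𝒲` has no positive eigenvalue. -/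
def KcPlus (g : FreqDensity) (W : Graphon) : EReal :=
  if W.posEigs.Nonempty then ((2 / (Real.pi * g.dens 0 * W.zetaMax) : ℝ) : EReal) else ⊤

open Classical in
/-- `K_c⁻ = 2 / (π g(0) ζ_min(𝒲))`, which is `-∞` if `𝒲` has no negative eigenvalue. -/
def KcMinus (g : FreqDensity) (W : Graphon) : EReal :=
  if W.negEigs.Nonempty then ((2 / (Real.pi * g.dens 0 * W.zetaMin) : ℝ) : EReal) else ⊥

end KMGraph

end

open KMGraph

/-!
With `J : L²(I) → L²(X)`, `J f (ω, x) = f x`, one has `𝒫 = J 𝒲 J*`, so `𝒫` is compact and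
self-adjoint and `T` is a compact perturbation of multiplication by `iω`, whose spectrum is
`i supp(g)` and which has no eigenvalues. By the Fredholm alternative, used in both directions,
every point off `i supp(g)` is in the resolvent set of `T` or is an eigenvalue of `T`, while no
point of `i supp(g)` is in the resolvent set of `T`.

An eigenvector of `T` at `z` has the form `v(ω, x) = (z - iω)⁻¹ b(x)`. Writing
`D(z) = ∫ (z - iω)⁻¹ g(ω) dω`, applying `J*` shows that `z` is an eigenvalue iff `(K/2) D(z) ζ = 1`
for some eigenvalue `ζ` of `𝒲`. As `ζ` is real, `D(z)` must be real and nonzero, which excludes the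
imaginary axis and, by the monotonicity of `g`, forces `z` to be real. Moreover `D(-z̄)` is the
negative conjugate of `D(z)`; since `T_K* = -T_{-K}`, the range of `T - z` is therefore dense iff
`T - z` is injective.

For `x > 0`, `D(x) = ∫ g(x t) / (1 + t²) dt` is continuous, lies strictly below its limit `π g(0)`
at `x = 0`, and tends to `0` at infinity. Hence a positive eigenvalue exists iff
`K ζ > 2 / (π g(0))` for some eigenvalue `ζ` of `𝒲`, that is, iff `K` is outside `[K_c⁻, K_c⁺]`.
-/

noncomputable section

namespace KMGraph

/-! ### Closed operators under bounded and compact perturbations -/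

section Resolvent

variable {E : Type*} [NormedAddCommGroup E] [NormedSpace ℂ E] {A : E →ₗ.[ℂ] E} {z : ℂ}
  {R : E →L[ℂ] E}

/-- `R` is the resolvent `(A - z)⁻¹`: the inverse of `A - z`, everywhere defined and bounded. The
equation `A v = u` is encoded as `(v, u) ∈ A.graph`, which keeps the domain out of sight. -/
def IsResolvent (A : E →ₗ.[ℂ] E) (z : ℂ) (R : E →L[ℂ] E) : Prop :=
  ∀ v u, (v, u) ∈ A.graph ↔ R (u - z • v) = v

theorem shift_apply (A : E →ₗ.[ℂ] E) (z : ℂ) (v : A.domain) : shift A z v = A v - z • (v : E) :=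
  rfl

theorem mem_resolventSet_iff : z ∈ resolventSet A ↔ ∃ R, IsResolvent A z R := by
  constructor
  · rintro ⟨hb, C, hC⟩
    let e := LinearEquiv.ofBijective (shift A z) hb
    have he (w : E) : shift A z (e.symm w) = w := e.apply_symm_apply w
    refine ⟨(A.domain.subtype ∘ₗ e.symm.toLinearMap).mkContinuous C fun w => ?_, fun v u => ?_⟩
    · simpa [he] using hC (e.symm w)
    · simp only [LinearMap.mkContinuous_apply, LinearMap.comp_apply, LinearEquiv.coe_coe,
        Submodule.subtype_apply]
      constructor
      · intro h
        obtain ⟨v, rfl, rfl⟩ := (LinearPMap.mem_graph_iff A).1 h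
        exact congrArg Subtype.val (e.symm_apply_apply v)
      · intro h
        have h' := he (u - z • v)
        rw [shift_apply, h, sub_left_inj] at h'
        exact (LinearPMap.mem_graph_iff A).2 ⟨_, h, h'⟩
  · rintro ⟨R, hR⟩
    have hleft (v : A.domain) : R (shift A z v) = v := (hR v (A v)).1 (A.mem_graph v)
    refine ⟨⟨fun v w hvw => ?_, fun w => ?_⟩, ‖R‖, fun v => ?_⟩
    · exact Subtype.ext (by rw [← hleft v, hvw, hleft w])
    · obtain ⟨v, hv, hvw⟩ := (LinearPMap.mem_graph_iff A).1
        ((hR (R w) (w + z • R w)).2 (by rw [add_sub_cancel_right]))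
      exact ⟨v, by rw [shift_apply, hvw, hv, add_sub_cancel_right]⟩
    · simpa [hleft] using R.le_opNorm (shift A z v)

theorem mem_pointSpectrum_iff : z ∈ pointSpectrum A ↔ ∃ v ≠ 0, (v, z • v) ∈ A.graph := by
  constructor
  · rintro ⟨v, hv, h⟩
    exact ⟨v, hv, h ▸ A.mem_graph v⟩
  · rintro ⟨v, hv, h⟩
    obtain ⟨w, rfl, h⟩ := (LinearPMap.mem_graph_iff A).1 h
    exact ⟨w, hv, h⟩

theorem injective_shift_iff : Function.Injective (shift A z) ↔ z ∉ pointSpectrum A := by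
  rw [injective_iff_map_eq_zero]
  refine ⟨fun h ⟨v, hv, hz⟩ => hv ?_, fun h v hv => ?_⟩
  · rw [h v (by rw [shift_apply, hz, sub_self]), ZeroMemClass.coe_zero]
  · by_contra hv0
    exact h ⟨v, by simpa using hv0, sub_eq_zero.1 hv⟩

theorem notMem_pointSpectrum (h : z ∈ resolventSet A) : z ∉ pointSpectrum A :=
  injective_shift_iff.1 h.1.1

theorem mem_graph_neg {v u : E} : (v, u) ∈ (-A).graph ↔ (v, -u) ∈ A.graph := by
  simp [LinearPMap.mem_graph_iff, neg_eq_iff_eq_neg]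

theorem neg_mem_pointSpectrum_neg : -z ∈ pointSpectrum (-A) ↔ z ∈ pointSpectrum A := by
  simp [mem_pointSpectrum_iff]

theorem IsResolvent.neg (h : IsResolvent A z R) : IsResolvent (-A) (-z) (-R) := fun v u => by
  rw [mem_graph_neg, h, neg_apply, ← map_neg, neg_sub, neg_smul]
  congr! 2
  abel

theorem IsResolvent.eq {A' : E →ₗ.[ℂ] E} (h : IsResolvent A z R) (h' : IsResolvent A' z R) :
    A = A' :=
  LinearPMap.eq_of_eq_graph <| Submodule.ext fun p => (h p.1 p.2).trans (h' p.1 p.2).symm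

theorem IsResolvent.isClosed (h : IsResolvent A z R) : A.IsClosed := by
  have hgraph : (A.graph : Set (E × E)) = {p | R (p.2 - z • p.1) = p.1} :=
    Set.ext fun p => h p.1 p.2
  rw [LinearPMap.IsClosed, hgraph]
  exact isClosed_eq (by fun_prop) (by fun_prop)

end Resolvent

section BoundedPerturbation

variable {E : Type*} [NormedAddCommGroup E] [NormedSpace ℂ E] {A : E →ₗ.[ℂ] E} {z : ℂ}

theorem mem_graph_vadd {B : E →ₗ[ℂ] E} {v u : E} :
    (v, u) ∈ (B +ᵥ A).graph ↔ (v, u - B v) ∈ A.graph := by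
  simp only [LinearPMap.mem_graph_iff]
  refine exists_congr fun w => and_congr_right ?_
  rintro rfl
  rw [LinearPMap.vadd_apply, eq_sub_iff_add_eq']

theorem isClosed_vadd (hA : A.IsClosed) (B : E →L[ℂ] E) : (B.toLinearMap +ᵥ A).IsClosed := by
  have hgraph : ((B.toLinearMap +ᵥ A).graph : Set (E × E)) =
      (fun p => (p.1, p.2 - B p.1)) ⁻¹' A.graph := Set.ext fun _ => mem_graph_vadd
  rw [LinearPMap.IsClosed, hgraph]
  exact IsClosed.preimage (by fun_prop) hA

theorem IsResolvent.vadd {R S : E →L[ℂ] E} (h : IsResolvent A z R) {B : E →L[ℂ] E}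
    (hl : S * (1 + R * B) = 1) (hr : (1 + R * B) * S = 1) :
    IsResolvent (B.toLinearMap +ᵥ A) z (S * R) := fun v u => by
  have hl' (w : E) : S (w + R (B w)) = w := DFunLike.congr_fun hl w
  have hr' (w : E) : S w + R (B (S w)) = w := DFunLike.congr_fun hr w
  rw [mem_graph_vadd, h, sub_right_comm, map_sub, sub_eq_iff_eq_add]
  exact ⟨fun hv => by rw [mul_apply_eq_comp]; simpa [hv] using hl' v,
    fun hv => by rw [← hr' (R (u - z • v)), ← mul_apply_eq_comp, hv]; rfl⟩

theorem mem_resolventSet_or_mem_pointSpectrum_vadd [CompleteSpace E] {B : E →L[ℂ] E}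
    (hB : IsCompactOperator B) (hz : z ∈ resolventSet A) :
    z ∈ resolventSet (B.toLinearMap +ᵥ A) ∨ z ∈ pointSpectrum (B.toLinearMap +ᵥ A) := by
  obtain ⟨R, hR⟩ := mem_resolventSet_iff.1 hz
  have hRB : IsCompactOperator (-(R * B)) := (hB.clm_comp R).neg
  rcases hRB.hasEigenvalue_or_mem_resolventSet (one_ne_zero (α := ℂ)) with h | h
  · obtain ⟨v, hv⟩ := h.exists_hasEigenvector
    refine .inr (mem_pointSpectrum_iff.2 ⟨v, hv.2, ?_⟩)
    rw [mem_graph_vadd, hR, sub_right_comm, sub_self, zero_sub, map_neg]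
    simpa using hv.apply_eq_smul
  · obtain ⟨S, hS⟩ : IsUnit (1 + R * B) := by
      simpa [spectrum.mem_resolventSet_iff, Algebra.algebraMap_eq_smul_one] using! h
    exact .inl (mem_resolventSet_iff.2 ⟨_, hR.vadd (S := ↑S⁻¹) (hS ▸ S.inv_mul) (hS ▸ S.mul_inv)⟩)

end BoundedPerturbation

section Adjoint

open scoped InnerProductSpace ComplexConjugate LinearPMap

variable {E : Type*} [NormedAddCommGroup E] [InnerProductSpace ℂ E] [CompleteSpace E]
  {A : E →ₗ.[ℂ] E} {z : ℂ}

theorem mem_graph_adjoint_iff (hA : Dense (A.domain : Set E)) {v u : E} :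
    (v, u) ∈ A†.graph ↔ ∀ a b, (a, b) ∈ A.graph → ⟪b, v⟫_ℂ = ⟪a, u⟫_ℂ := by
  simp only [LinearPMap.adjoint_graph_eq_graph_adjoint hA, Submodule.mem_adjoint_iff, sub_eq_zero]

theorem denseRange_shift_iff (hA : Dense (A.domain : Set E)) :
    DenseRange (shift A z) ↔ conj z ∉ pointSpectrum A† := by
  have hker (v : E) : v ∈ (shift A z).rangeᗮ ↔ (v, conj z • v) ∈ A†.graph := by
    simp only [Submodule.mem_orthogonal, LinearMap.mem_range, forall_exists_index,
      forall_apply_eq_imp_iff, mem_graph_adjoint_iff hA, LinearPMap.mem_graph_iff, and_imp,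
      shift_apply, inner_sub_left, inner_smul_left, inner_smul_right, sub_eq_zero]
    exact ⟨fun h a b w ha hb => ha ▸ hb ▸ h w, fun h w => h _ _ w rfl rfl⟩
  rw [DenseRange, ← LinearMap.coe_range, Submodule.dense_iff_topologicalClosure_eq_top,
    Submodule.topologicalClosure_eq_top_iff, Submodule.eq_bot_iff, mem_pointSpectrum_iff]
  simp only [hker]
  grind

theorem adjoint_vadd (hA : Dense (A.domain : Set E)) (B : E →L[ℂ] E) :
    (B.toLinearMap +ᵥ A)† = B.adjoint.toLinearMap +ᵥ A† := by
  refine LinearPMap.eq_of_eq_graph (Submodule.ext fun ⟨v, u⟩ => ?_)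
  rw [mem_graph_vadd, mem_graph_adjoint_iff hA, mem_graph_adjoint_iff (A := _ +ᵥ A) hA]
  simp only [mem_graph_vadd, ContinuousLinearMap.coe_coe, inner_sub_right,
    ContinuousLinearMap.adjoint_inner_right, eq_sub_iff_add_eq, ← inner_add_left]
  refine forall_congr' fun a => ⟨fun h b hb => h _ ?_, fun h b hb => ?_⟩
  · rwa [add_sub_cancel_right]
  · simpa using h _ hb

theorem IsResolvent.adjoint {R : E →L[ℂ] E} (hA : Dense (A.domain : Set E))
    (h : IsResolvent A z R) : IsResolvent A† (conj z) R.adjoint := fun v u => by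
  have hgraph (w : E) : (R w, w + z • R w) ∈ A.graph := by simp [h _ _]
  rw [mem_graph_adjoint_iff hA]
  refine ⟨fun hv => ?_, fun hv a b hab => ?_⟩
  · refine ext_inner_left ℂ fun w => ?_
    have := hv _ _ (hgraph w)
    rw [inner_add_left, inner_smul_left] at this
    rw [ContinuousLinearMap.adjoint_inner_right, inner_sub_right, inner_smul_right, ← this,
      add_sub_cancel_right]
  · rw [← sub_add_cancel b (z • a), inner_add_left, ← hv,
      ContinuousLinearMap.adjoint_inner_right, (h a b).1 hab]
    simp [inner_sub_right, inner_smul_left, inner_smul_right, hv]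

theorem IsResolvent.dense_domain {R : E →L[ℂ] E} (h : IsResolvent A z R)
    (hR : Function.Injective R.adjoint) : Dense (A.domain : Set E) := by
  have hrange : R.range ≤ A.domain := by
    rintro _ ⟨w, rfl⟩
    exact A.mem_domain_of_mem_graph ((h (R w) (w + z • R w)).2 (by rw [add_sub_cancel_right]))
  refine Dense.mono hrange ?_
  rw [Submodule.dense_iff_topologicalClosure_eq_top, Submodule.topologicalClosure_eq_top_iff,
    ContinuousLinearMap.orthogonal_range]
  exact LinearMap.ker_eq_bot.2 hR

end Adjoint

/-! ### Hilbert–Schmidt operators are compact -/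

section Tensor

variable {α β : Type*} [MeasurableSpace α] [MeasurableSpace β] {μ : Measure α} {ν : Measure β}

theorem memLp_two_tensor {u : α → ℂ} {v : β → ℂ} (hu : MemLp u 2 μ) (hv : MemLp v 2 ν) :
    MemLp (fun p : α × β => u p.1 * v p.2) 2 (μ.prod ν) := by
  have hm : AEStronglyMeasurable (fun p : α × β => u p.1 * v p.2) (μ.prod ν) :=
    hu.1.comp_fst.mul hv.1.comp_snd
  rw [memLp_two_iff_integrable_sq_norm hm]
  simpa [mul_pow] using ((memLp_two_iff_integrable_sq_norm hu.1).1 hu).mul_prod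
    ((memLp_two_iff_integrable_sq_norm hv.1).1 hv)

/-- The elementary tensor `u ⊗ v`, realized as the function `(x, y) ↦ u x * v y` in `L²(μ × ν)`. -/
def tensor (u : Lp ℂ 2 μ) (v : Lp ℂ 2 ν) : Lp ℂ 2 (μ.prod ν) :=
  (memLp_two_tensor (Lp.memLp u) (Lp.memLp v)).toLp

theorem coeFn_tensor (u : Lp ℂ 2 μ) (v : Lp ℂ 2 ν) :
    tensor u v =ᵐ[μ.prod ν] fun p => u p.1 * v p.2 :=
  MemLp.coeFn_toLp _

theorem norm_sq_eq_integral (v : Lp ℂ 2 ν) : ‖v‖ ^ 2 = ∫ y, ‖v y‖ ^ 2 ∂ν := by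
  have h := inner_self_eq_norm_sq_to_K (𝕜 := ℂ) v
  simp only [L2.inner_def, fun y => inner_self_eq_norm_sq_to_K (𝕜 := ℂ) (v y)] at h
  rw [← Complex.ofReal_inj, ← integral_complex_ofReal]
  simpa using h.symm

theorem norm_star_eq (v : Lp ℂ 2 ν) : ‖star v‖ = ‖v‖ := by
  rw [Lp.norm_def, Lp.norm_def, eLpNorm_congr_ae (Lp.coeFn_star v), eLpNorm_star]

theorem norm_tensor [SFinite μ] [SFinite ν] (u : Lp ℂ 2 μ) (v : Lp ℂ 2 ν) :
    ‖tensor u v‖ = ‖u‖ * ‖v‖ := by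
  rw [← sq_eq_sq₀ (norm_nonneg _) (by positivity), mul_pow]
  simp only [norm_sq_eq_integral]
  rw [← integral_prod_mul]
  refine integral_congr_ae ?_
  filter_upwards [coeFn_tensor u v] with p hp
  rw [hp, norm_mul, mul_pow]

end Tensor

section HilbertSchmidt

open scoped InnerProductSpace ComplexConjugate

variable {α : Type*} [MeasurableSpace α] {μ : Measure α} {k : α → α → ℂ}

theorem integrable_kernel_mul (hk : MemLp (Function.uncurry k) 2 (μ.prod μ)) (h f : Lp ℂ 2 μ) :
    Integrable (fun p : α × α => conj (h p.1) * k p.1 p.2 * f p.2) (μ.prod μ) := by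
  refine (hk.integrable_mul (memLp_two_tensor (Lp.memLp h).star (Lp.memLp f))).congr
    (.of_forall fun p => ?_)
  simp only [Pi.mul_apply, Function.uncurry, Pi.star_apply, RCLike.star_def]
  ring

theorem memLp_uncurry (κ : Lp ℂ 2 (μ.prod μ)) :
    MemLp (Function.uncurry fun x y => κ (x, y)) 2 (μ.prod μ) := Lp.memLp κ

variable [SFinite μ]

theorem kernelOp_coeFn (hk : MemLp (Function.uncurry k) 2 (μ.prod μ)) (f : Lp ℂ 2 μ) :
    kernelOp k hk f =ᵐ[μ] fun x => ∫ y, k x y * f y ∂μ :=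
  (kernel_memLp hk f).coeFn_toLp

theorem inner_kernelOp (hk : MemLp (Function.uncurry k) 2 (μ.prod μ)) (h f : Lp ℂ 2 μ) :
    ⟪h, kernelOp k hk f⟫_ℂ = ∫ p : α × α, conj (h p.1) * k p.1 p.2 * f p.2 ∂(μ.prod μ) := by
  rw [integral_prod _ (integrable_kernel_mul hk h f), L2.inner_def]
  refine integral_congr_ae ?_
  filter_upwards [kernelOp_coeFn hk f] with x hx
  rw [hx, RCLike.inner_apply, mul_comm, ← integral_const_mul]
  simp only [mul_assoc]

theorem kernelOp_inner_comm (hk : MemLp (Function.uncurry k) 2 (μ.prod μ))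
    (hs : ∀ x y, conj (k x y) = k y x) (h f : Lp ℂ 2 μ) :
    ⟪h, kernelOp k hk f⟫_ℂ = ⟪kernelOp k hk h, f⟫_ℂ := by
  rw [← inner_conj_symm (kernelOp k hk h) f, inner_kernelOp, inner_kernelOp, ← integral_conj,
    ← integral_prod_swap]
  refine integral_congr_ae (.of_forall fun p => ?_)
  simp only [Prod.fst_swap, Prod.snd_swap, map_mul, hs, Complex.conj_conj]
  ring

theorem inner_tensor_star (κ : Lp ℂ 2 (μ.prod μ)) (h f : Lp ℂ 2 μ) :
    ⟪tensor h (star f), κ⟫_ℂ = ⟪h, kernelOp (fun x y => κ (x, y)) (memLp_uncurry κ) f⟫_ℂ := by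
  rw [inner_kernelOp, L2.inner_def]
  refine integral_congr_ae ?_
  filter_upwards [coeFn_tensor h (star f),
    Measure.quasiMeasurePreserving_snd.ae (Lp.coeFn_star f)] with p hp hf
  rw [hp, hf, RCLike.inner_apply, Pi.star_apply, RCLike.star_def, map_mul, Complex.conj_conj]
  ring

theorem norm_kernelOp_le (κ : Lp ℂ 2 (μ.prod μ)) (f : Lp ℂ 2 μ) :
    ‖kernelOp (fun x y => κ (x, y)) (memLp_uncurry κ) f‖ ≤ ‖κ‖ * ‖f‖ := by
  set w := kernelOp (fun x y => κ (x, y)) (memLp_uncurry κ) f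
  have h : ‖w‖ * ‖w‖ ≤ ‖w‖ * (‖κ‖ * ‖f‖) :=
    calc ‖w‖ * ‖w‖ = ‖⟪tensor w (star f), κ⟫_ℂ‖ := by
          rw [inner_tensor_star, inner_self_eq_norm_sq_to_K]; simp [sq, w]
      _ ≤ ‖tensor w (star f)‖ * ‖κ‖ := norm_inner_le_norm _ _
      _ = ‖w‖ * (‖κ‖ * ‖f‖) := by rw [norm_tensor, norm_star_eq]; ring
  rcases (norm_nonneg w).eq_or_lt with h0 | h0
  · rw [← h0]; positivity
  · exact le_of_mul_le_mul_left h h0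

/-- The map sending a square-integrable kernel to its Hilbert–Schmidt operator. -/
def hilbertSchmidt : Lp ℂ 2 (μ.prod μ) →L[ℂ] Lp ℂ 2 μ →L[ℂ] Lp ℂ 2 μ :=
  LinearMap.mkContinuous₂
    (LinearMap.mk₂ ℂ (fun κ => kernelOp (fun x y => κ (x, y)) (memLp_uncurry κ))
      (fun κ κ' f => ext_inner_left ℂ fun h => by
        simp only [inner_add_right, ← inner_tensor_star])
      (fun c κ f => ext_inner_left ℂ fun h => by
        simp only [inner_smul_right, ← inner_tensor_star])
      (fun κ => map_add _) (fun c κ => map_smul _ c)) 1 fun κ f => by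
    rw [one_mul]
    exact norm_kernelOp_le κ f

theorem inner_hilbertSchmidt (κ : Lp ℂ 2 (μ.prod μ)) (h f : Lp ℂ 2 μ) :
    ⟪h, hilbertSchmidt κ f⟫_ℂ = ⟪tensor h (star f), κ⟫_ℂ :=
  (inner_tensor_star κ h f).symm

theorem hilbertSchmidt_toLp (hk : MemLp (Function.uncurry k) 2 (μ.prod μ)) (f : Lp ℂ 2 μ) :
    hilbertSchmidt hk.toLp f = kernelOp k hk f := by
  refine ext_inner_left ℂ fun h => ?_
  rw [inner_hilbertSchmidt, inner_tensor_star, inner_kernelOp, inner_kernelOp]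
  refine integral_congr_ae ?_
  filter_upwards [hk.coeFn_toLp] with p hp
  simp only [Prod.mk.eta, hp, Function.uncurry]

theorem hilbertSchmidt_tensor (u v : Lp ℂ 2 μ) :
    hilbertSchmidt (tensor u v) = (innerSL ℂ (star v)).smulRight u := by
  ext1 f
  refine ext_inner_left ℂ fun h => ?_
  rw [inner_hilbertSchmidt, ContinuousLinearMap.smulRight_apply, innerSL_apply_apply,
    inner_smul_right, mul_comm, L2.inner_def, L2.inner_def, L2.inner_def, ← integral_prod_mul]
  refine integral_congr_ae ?_
  filter_upwards [coeFn_tensor u v, coeFn_tensor h (star f),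
    Measure.quasiMeasurePreserving_snd.ae (Lp.coeFn_star f),
    Measure.quasiMeasurePreserving_snd.ae (Lp.coeFn_star v)] with p huv hhf hf hv
  simp only [huv, hhf, hf, hv, RCLike.inner_apply, Pi.star_apply, RCLike.star_def, map_mul,
    Complex.conj_conj]
  ring

theorem isCompactOperator_smulRight {E : Type*} [NormedAddCommGroup E] [NormedSpace ℂ E]
    (φ : E →L[ℂ] ℂ) (v : E) : IsCompactOperator (φ.smulRight v : E →L[ℂ] E) :=
  (isCompactOperator_of_locallyCompactSpace_dom φ).clm_comp
    (ContinuousLinearMap.toSpanSingleton ℂ v)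

theorem isCompactOperator_hilbertSchmidt (κ : Lp ℂ 2 (μ.prod μ)) :
    IsCompactOperator (hilbertSchmidt κ) := by
  let S : Submodule ℂ (Lp ℂ 2 (μ.prod μ)) :=
    (compactOperator (RingHom.id ℂ) (Lp ℂ 2 μ) (Lp ℂ 2 μ)).comap
      (hilbertSchmidt (μ := μ)).toLinearMap
  have hS : IsClosed (S : Set (Lp ℂ 2 (μ.prod μ))) :=
    isClosed_setOfPred_isCompactOperator.preimage (hilbertSchmidt (μ := μ)).continuous
  have htensor (u v : Lp ℂ 2 μ) : tensor u v ∈ S := by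
    change IsCompactOperator (hilbertSchmidt (tensor u v))
    rw [hilbertSchmidt_tensor]
    exact isCompactOperator_smulRight _ _
  -- A kernel orthogonal to all tensors has zero operator, which is compact.
  have horth : Sᗮ = ⊥ := by
    refine (Submodule.eq_bot_iff _).2 fun f hf => ?_
    have hzero : hilbertSchmidt f = 0 := by
      ext1 v
      refine ext_inner_left ℂ fun u => ?_
      rw [inner_hilbertSchmidt, (Submodule.mem_orthogonal S f).1 hf _ (htensor u (star v)),
        zero_apply, inner_zero_right]
    have hfS : f ∈ S := by
      change IsCompactOperator (hilbertSchmidt f)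
      rw [hzero]
      exact isCompactOperator_zero
    exact inner_self_eq_zero.1 ((Submodule.mem_orthogonal S f).1 hf f hfS)
  have hT : S = ⊤ := by
    rwa [← hS.submodule_topologicalClosure_eq, Submodule.topologicalClosure_eq_top_iff]
  exact (hT ▸ Submodule.mem_top : κ ∈ S)

/-- The kernel operator `kernelOp k hk` as a continuous linear map. -/
def kernelCLM (k : α → α → ℂ) (hk : MemLp (Function.uncurry k) 2 (μ.prod μ)) :
    Lp ℂ 2 μ →L[ℂ] Lp ℂ 2 μ :=
  hilbertSchmidt hk.toLp

theorem kernelCLM_apply (hk : MemLp (Function.uncurry k) 2 (μ.prod μ)) (f : Lp ℂ 2 μ) :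
    kernelCLM k hk f = kernelOp k hk f :=
  hilbertSchmidt_toLp hk f

theorem isCompactOperator_kernelCLM (hk : MemLp (Function.uncurry k) 2 (μ.prod μ)) :
    IsCompactOperator (kernelCLM k hk) :=
  isCompactOperator_hilbertSchmidt _

end HilbertSchmidt

/-! ### Extreme eigenvalues of a graphon -/

section Extremes

variable {α : Type*} [ConditionallyCompleteLinearOrder α] [TopologicalSpace α]
  [OrderTopology α] {s : Set α} {a : α}

theorem isGreatest_sSup_inter_Ioi (hs : IsCompact s) (h : (s ∩ Ioi a).Nonempty) :
    IsGreatest (s ∩ Ioi a) (sSup (s ∩ Ioi a)) := by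
  obtain ⟨b, hbs, hab⟩ := h
  obtain ⟨m, ⟨hms, hbm⟩, hm⟩ := (hs.inter_right isClosed_Ici).exists_isGreatest
    ⟨b, hbs, mem_Ici.2 le_rfl⟩
  have hgreatest : IsGreatest (s ∩ Ioi a) m :=
    ⟨⟨hms, lt_of_lt_of_le hab hbm⟩, fun x hx =>
      (le_total b x).elim (fun hbx => hm ⟨hx.1, hbx⟩) fun hxb => hxb.trans hbm⟩
  rwa [hgreatest.csSup_eq]

theorem isLeast_sInf_inter_Iio (hs : IsCompact s) (h : (s ∩ Iio a).Nonempty) :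
    IsLeast (s ∩ Iio a) (sInf (s ∩ Iio a)) :=
  isGreatest_sSup_inter_Ioi (α := αᵒᵈ) hs h

end Extremes

namespace Graphon

open scoped ComplexConjugate

variable (W : Graphon)

/-- The kernel operator `𝒲` on `L²(I)` as a bounded operator. -/
def clm : Lp ℂ 2 (volume : Measure I) →L[ℂ] Lp ℂ 2 (volume : Measure I) :=
  kernelCLM (fun x y => (W.kernel x y : ℂ)) W.memLp_complex

theorem coe_clm : (W.clm : Module.End ℂ (Lp ℂ 2 (volume : Measure I))) = W.op :=
  LinearMap.ext fun f => kernelCLM_apply W.memLp_complex f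

theorem op_coeFn (f : Lp ℂ 2 (volume : Measure I)) :
    W.op f =ᵐ[volume] fun x => ∫ y, (W.kernel x y : ℂ) * f y :=
  kernelOp_coeFn W.memLp_complex f

theorem isSymmetric_op : W.op.IsSymmetric := fun f h =>
  (kernelOp_inner_comm W.memLp_complex (fun x y => by rw [Complex.conj_ofReal, W.symm]) f h).symm

variable {W}

theorem exists_ofReal_eq_of_hasEigenvalue {ζ : ℂ} (h : Module.End.HasEigenvalue W.op ζ) :
    ∃ r : ℝ, (r : ℂ) = ζ :=
  (Complex.conj_eq_iff_real.1 (W.isSymmetric_op.conj_eigenvalue_eq_self h)).imp fun _ => Eq.symm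

variable (W)

/-- The real part `σ(𝒲) ∩ ℝ` of the spectrum, as a set of reals. -/
def realSpectrum : Set ℝ := {x | (x : ℂ) ∈ spectrum ℂ W.clm}

theorem isCompact_realSpectrum : IsCompact W.realSpectrum :=
  Complex.isometry_ofReal.isClosedEmbedding.isCompact_preimage (spectrum.isCompact W.clm)

variable {W}

theorem hasEigenvalue_op_iff {x : ℝ} (hx : x ≠ 0) :
    Module.End.HasEigenvalue W.op (x : ℂ) ↔ x ∈ W.realSpectrum := by
  rw [← W.coe_clm]
  exact (isCompactOperator_kernelCLM W.memLp_complex).hasEigenvalue_iff_mem_spectrum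
    (Complex.ofReal_ne_zero.2 hx)

variable (W)

theorem posEigs_eq : W.posEigs = W.realSpectrum ∩ Ioi 0 :=
  ext fun _ => and_comm.trans (and_congr_left fun hx => hasEigenvalue_op_iff (ne_of_gt hx))

theorem negEigs_eq : W.negEigs = W.realSpectrum ∩ Iio 0 :=
  ext fun _ => and_comm.trans (and_congr_left fun hx => hasEigenvalue_op_iff (ne_of_lt hx))

theorem isGreatest_zetaMax (h : W.posEigs.Nonempty) : IsGreatest W.posEigs W.zetaMax := by
  rw [posEigs_eq] at h
  rw [zetaMax, posEigs_eq]
  exact isGreatest_sSup_inter_Ioi W.isCompact_realSpectrum h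

theorem isLeast_zetaMin (h : W.negEigs.Nonempty) : IsLeast W.negEigs W.zetaMin := by
  rw [negEigs_eq] at h
  rw [zetaMin, negEigs_eq]
  exact isLeast_sInf_inter_Iio W.isCompact_realSpectrum h

end Graphon

/-! ### The Cauchy transform of a frequency density -/

section CauchyTransform

open scoped ComplexConjugate

/-- The Cauchy transform `∫ (z - iω)⁻¹ dν(ω)` of a measure `ν` on the imaginary axis. -/
def cauchyTransform (ν : Measure ℝ) (z : ℂ) : ℂ := ∫ ω : ℝ, (z - Complex.I * ω)⁻¹ ∂ν

theorem norm_inv_sub_I_mul_le {z : ℂ} (hz : z.re ≠ 0) (ω : ℝ) :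
    ‖(z - Complex.I * ω)⁻¹‖ ≤ |z.re|⁻¹ := by
  rw [norm_inv]
  exact inv_anti₀ (abs_pos.2 hz) (by simpa using Complex.abs_re_le_norm (z - Complex.I * ω))

theorem integrable_inv_sub_I_mul (ν : Measure ℝ) [IsFiniteMeasure ν] {z : ℂ} (hz : z.re ≠ 0) :
    Integrable (fun ω : ℝ => (z - Complex.I * ω)⁻¹) ν :=
  .of_bound (by fun_prop) |z.re|⁻¹ (.of_forall (norm_inv_sub_I_mul_le hz))

theorem inv_sub_I_mul_re (z : ℂ) (ω : ℝ) :
    ((z - Complex.I * ω)⁻¹).re = z.re / (z.re ^ 2 + (ω - z.im) ^ 2) := by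
  have h_re : (z - Complex.I * ω).re = z.re := by simp
  have h_im : (z - Complex.I * ω).im = z.im - ω := by simp
  rw [Complex.inv_re, Complex.normSq_apply, h_re, h_im]
  ring_nf

theorem inv_sub_I_mul_im (z : ℂ) (ω : ℝ) :
    ((z - Complex.I * ω)⁻¹).im = (ω - z.im) / (z.re ^ 2 + (ω - z.im) ^ 2) := by
  have h_re : (z - Complex.I * ω).re = z.re := by simp
  have h_im : (z - Complex.I * ω).im = z.im - ω := by simp
  rw [Complex.inv_im, Complex.normSq_apply, h_re, h_im]
  ring_nf

theorem cauchyTransform_neg_conj (ν : Measure ℝ) (z : ℂ) :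
    cauchyTransform ν (-conj z) = -conj (cauchyTransform ν z) := by
  rw [cauchyTransform, cauchyTransform, ← integral_conj, ← integral_neg]
  congr with ω
  rw [map_inv₀, ← inv_neg]
  simp [sub_eq_add_neg, add_comm]

theorem re_cauchyTransform_eq_zero (ν : Measure ℝ) {z : ℂ} (hz : z.re = 0) :
    (cauchyTransform ν z).re = 0 := by
  have hconj : -conj z = z := by apply Complex.ext <;> simp [hz]
  have h := congrArg Complex.re (cauchyTransform_neg_conj ν z)
  rw [hconj, Complex.neg_re, Complex.conj_re] at h
  linarith

end CauchyTransform

namespace FreqDensity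

open scoped ComplexConjugate
open Filter Topology

variable (g : FreqDensity)

theorem integrable_dens : Integrable g.dens := by
  by_contra h
  exact zero_ne_one ((integral_undef h).symm.trans g.integral_eq_one)

theorem antitoneOn_Ici : AntitoneOn g.dens (Ici 0) := by
  rw [← Ioi_insert]
  exact (g.antitoneOn.dual_right.insert_of_continuousWithinAt
    (mem_closure_iff_clusterPt.1 (by simp)) g.continuous.continuousWithinAt).dual_right

theorem dens_le_of_abs_le {a b : ℝ} (h : |a| ≤ |b|) : g.dens b ≤ g.dens a := by
  have dens_abs (t : ℝ) : g.dens |t| = g.dens t := by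
    rcases abs_choice t with ht | ht <;> rw [ht]
    exact g.even t
  rw [← dens_abs a, ← dens_abs b]
  exact g.antitoneOn_Ici (abs_nonneg a) (abs_nonneg b) h

theorem dens_le_dens_zero (a : ℝ) : g.dens a ≤ g.dens 0 :=
  g.dens_le_of_abs_le (by simp)

theorem exists_dens_ne_dens_zero : ∃ t, g.dens t ≠ g.dens 0 := by
  by_contra! h
  have hconst : ∫ _ : ℝ, g.dens 0 = 1 :=
    (integral_congr_ae (.of_forall h)).symm.trans g.integral_eq_one
  simp [measureReal_def] at hconst

theorem dens_zero_pos : 0 < g.dens 0 := by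
  obtain ⟨t, ht⟩ := g.exists_dens_ne_dens_zero
  exact (g.nonneg t).trans_lt ((g.dens_le_dens_zero t).lt_of_ne ht)

theorem not_periodic {p : ℝ} (hp : p ≠ 0) : ¬ Function.Periodic g.dens p := by
  intro hper
  obtain ⟨t, ht⟩ := g.exists_dens_ne_dens_zero
  obtain ⟨n, hn⟩ := exists_nat_ge (|t| / |p|)
  have hnp : g.dens (n * p) = g.dens 0 := by simpa using hper.nat_mul n 0
  have htn : |t| ≤ |n * p| := by
    rw [abs_mul, Nat.abs_cast]
    exact (div_le_iff₀ (abs_pos.2 hp)).1 hn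
  exact ht ((g.dens_le_dens_zero t).antisymm (hnp ▸ g.dens_le_of_abs_le htn))

theorem integral_measure {E : Type*} [NormedAddCommGroup E] [NormedSpace ℝ E] (f : ℝ → E) :
    ∫ ω, f ω ∂g.measure = ∫ ω, g.dens ω • f ω := by
  rw [measure, integral_withDensity_eq_integral_toReal_smul₀
    g.continuous.measurable.ennreal_ofReal.aemeasurable (by simp)]
  simp [ENNReal.toReal_ofReal (g.nonneg _)]

instance nullSingletonClass_measure : NullSingletonClass g.measure :=
  ⟨fun _ => withDensity_absolutelyContinuous _ _ (measure_singleton _)⟩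

theorem ae_mem_tsupport : ∀ᵐ ω ∂g.measure, ω ∈ tsupport g.dens := by
  rw [measure, ae_withDensity_iff g.continuous.measurable.ennreal_ofReal]
  refine .of_forall fun ω hω => subset_tsupport _ fun h => hω ?_
  rw [h, ENNReal.ofReal_zero]

theorem measure_pos_of_mem_tsupport {τ : ℝ} (hτ : τ ∈ tsupport g.dens) {U : Set ℝ}
    (hU : IsOpen U) (hτU : τ ∈ U) : 0 < g.measure U := by
  have hpos : {ω | ENNReal.ofReal (g.dens ω) ≠ 0} = Function.support g.dens := by
    ext ω
    simp [(g.nonneg ω).lt_iff_ne, ne_comm]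
  rw [pos_iff_ne_zero, measure, Ne,
    withDensity_apply_eq_zero g.continuous.measurable.ennreal_ofReal, hpos, inter_comm]
  exact ((hU.inter g.continuous.isOpen_support).measure_pos volume
    (mem_closure_iff.1 hτ U hU hτU)).ne'

theorem cauchyTransform_conj (z : ℂ) :
    cauchyTransform g.measure (conj z) = conj (cauchyTransform g.measure z) := by
  rw [cauchyTransform, cauchyTransform, ← integral_conj, g.integral_measure, g.integral_measure,
    ← integral_neg_eq_self]
  simp [g.even]

theorem integrable_dens_comp_add_mul {x : ℝ} (hx : x ≠ 0) (y : ℝ) :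
    Integrable fun s => g.dens (s + y) * (s / (x ^ 2 + s ^ 2)) := by
  have him (s : ℝ) : ((x - Complex.I * s)⁻¹).im = s / (x ^ 2 + s ^ 2) := by
    rw [inv_sub_I_mul_im]
    simp
  simp only [← him]
  refine (g.integrable_dens.comp_add_right y).mul_bdd (c := |x|⁻¹) (by fun_prop)
    (.of_forall fun s => (Complex.abs_im_le_norm _).trans ?_)
  exact norm_inv_sub_I_mul_le (z := x) (by simpa using hx) s

theorem im_cauchyTransform {z : ℂ} (hz : z.re ≠ 0) :
    (cauchyTransform g.measure z).im = ∫ s, g.dens (s + z.im) * (s / (z.re ^ 2 + s ^ 2)) := by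
  rw [cauchyTransform, ← Complex.imCLM_apply,
    ← Complex.imCLM.integral_comp_comm (integrable_inv_sub_I_mul _ hz), g.integral_measure,
    ← integral_add_right_eq_self _ z.im]
  simp only [Complex.imCLM_apply, inv_sub_I_mul_im, add_sub_cancel_right, smul_eq_mul]

theorem two_mul_im_cauchyTransform {z : ℂ} (hz : z.re ≠ 0) :
    2 * (cauchyTransform g.measure z).im =
      ∫ s, (g.dens (s + z.im) - g.dens (s - z.im)) * (s / (z.re ^ 2 + s ^ 2)) := by
  have him : (cauchyTransform g.measure z).im =
      -∫ s, g.dens (s - z.im) * (s / (z.re ^ 2 + s ^ 2)) := by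
    rw [g.im_cauchyTransform hz, ← integral_neg_eq_self, ← integral_neg]
    congr with s
    rw [← g.even, neg_sq]
    ring_nf
  have hint := g.integrable_dens_comp_add_mul hz (-z.im)
  simp only [sub_mul, ← sub_eq_add_neg] at hint ⊢
  rw [integral_sub (g.integrable_dens_comp_add_mul hz _) hint, ← g.im_cauchyTransform hz]
  linarith

theorem mul_dens_sub_dens_nonneg (y s : ℝ) :
    0 ≤ y * s * (g.dens (s - y) - g.dens (s + y)) := by
  rcases le_total 0 (y * s) with h | h
  · exact mul_nonneg h (sub_nonneg.2 (g.dens_le_of_abs_le (sq_le_sq.1 (by nlinarith))))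
  · exact mul_nonneg_of_nonpos_of_nonpos h
      (sub_nonpos.2 (g.dens_le_of_abs_le (sq_le_sq.1 (by nlinarith))))

theorem im_eq_zero_of_im_cauchyTransform_eq_zero {z : ℂ} (hz : z.re ≠ 0)
    (h : (cauchyTransform g.measure z).im = 0) : z.im = 0 := by
  by_contra hy
  have hdens := g.continuous
  have hden (s : ℝ) : z.re ^ 2 + s ^ 2 ≠ 0 := by positivity
  let q (s : ℝ) : ℝ := (g.dens (s + z.im) - g.dens (s - z.im)) * (s / (z.re ^ 2 + s ^ 2))
  have hq_cont : Continuous q := by fun_prop (disch := exact hden _)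
  have hq_int : Integrable q := by
    have hint := g.integrable_dens_comp_add_mul hz (-z.im)
    simp only [q, sub_mul, ← sub_eq_add_neg] at hint ⊢
    exact (g.integrable_dens_comp_add_mul hz _).sub hint
  have hq_sign (s : ℝ) : 0 ≤ -z.im * q s := by
    have hq : -z.im * q s =
        z.im * s * (g.dens (s - z.im) - g.dens (s + z.im)) / (z.re ^ 2 + s ^ 2) := by
      ring
    exact hq ▸ div_nonneg (g.mul_dens_sub_dens_nonneg z.im s) (by positivity)
  have hq_zero (s : ℝ) : q s = 0 := by
    by_contra hs
    refine (integral_pos_of_integrable_nonneg_nonzero (f := fun s => -z.im * q s) (x := s)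
      (by fun_prop) (hq_int.const_mul _) hq_sign (mul_ne_zero (neg_ne_zero.2 hy) hs)).ne' ?_
    rw [integral_const_mul, ← g.two_mul_im_cauchyTransform hz, h, mul_zero, mul_zero]
  refine g.not_periodic (mul_ne_zero two_ne_zero hy) fun t => ?_
  rcases mul_eq_zero.1 (hq_zero (t + z.im)) with ht | ht
  · rw [sub_eq_zero] at ht
    rw [two_mul, ← add_assoc, ht, add_sub_cancel_right]
  · have ht : t + z.im = 0 := (div_eq_zero_iff.1 ht).resolve_right (hden _)
    rw [← g.even t]
    congr 1
    linarith

/-- The profile `∫ g(xt) / (1 + t²) dt`. It equals the Cauchy transform of `g(ω) dω` at `x > 0` and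
extends it continuously to `x = 0`. -/
def profile (x : ℝ) : ℝ := ∫ t, g.dens (x * t) * (1 + t ^ 2)⁻¹

theorem integrable_profile (x : ℝ) : Integrable fun t : ℝ => g.dens (x * t) * (1 + t ^ 2)⁻¹ := by
  refine integrable_inv_one_add_sq.bdd_mul (c := g.dens 0)
    (g.continuous.comp (by fun_prop)).aestronglyMeasurable (.of_forall fun t => ?_)
  rw [Real.norm_of_nonneg (g.nonneg _)]
  exact g.dens_le_dens_zero _

theorem profile_zero : g.profile 0 = Real.pi * g.dens 0 := by
  simp only [profile, zero_mul]
  rw [integral_const_mul, integral_univ_inv_one_add_sq, mul_comm]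

theorem profile_lt {x : ℝ} (hx : x ≠ 0) : g.profile x < Real.pi * g.dens 0 := by
  obtain ⟨t, ht⟩ := g.exists_dens_ne_dens_zero
  have hdens := g.continuous
  have hpos : 0 < ∫ t, (g.dens (0 * t) * (1 + t ^ 2)⁻¹ - g.dens (x * t) * (1 + t ^ 2)⁻¹) := by
    have hden (t : ℝ) : 1 + t ^ 2 ≠ 0 := by positivity
    refine integral_pos_of_integrable_nonneg_nonzero (x := t / x)
      (by fun_prop (disch := exact hden _))
      ((g.integrable_profile 0).sub (g.integrable_profile x)) (fun s => ?_) ?_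
    · rw [← sub_mul, zero_mul]
      exact mul_nonneg (sub_nonneg.2 (g.dens_le_dens_zero _)) (by positivity)
    · rw [← sub_mul, zero_mul, mul_div_cancel₀ t hx]
      exact mul_ne_zero (sub_ne_zero.2 ht.symm) (inv_ne_zero (hden _))
  rw [integral_sub (g.integrable_profile 0) (g.integrable_profile x)] at hpos
  exact g.profile_zero ▸ sub_pos.1 hpos

theorem continuous_profile : Continuous g.profile := by
  refine continuous_of_dominated (bound := fun t => g.dens 0 * (1 + t ^ 2)⁻¹)
    (fun x => (g.integrable_profile x).aestronglyMeasurable) (fun x => .of_forall fun t => ?_)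
    (integrable_inv_one_add_sq.const_mul _) (.of_forall fun t => ?_)
  · rw [Real.norm_of_nonneg (mul_nonneg (g.nonneg _) (by positivity))]
    exact mul_le_mul_of_nonneg_right (g.dens_le_dens_zero _) (by positivity)
  · exact (g.continuous.comp (by fun_prop)).mul continuous_const

theorem profile_le {x : ℝ} (hx : 0 < x) : g.profile x ≤ x⁻¹ := by
  have hscale : ∫ t, g.dens (x * t) = x⁻¹ := by
    rw [Measure.integral_comp_mul_left g.dens x, g.integral_eq_one, abs_of_pos (inv_pos.2 hx),
      smul_eq_mul, mul_one]
  rw [← hscale]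
  refine integral_mono (g.integrable_profile x) (g.integrable_dens.comp_mul_left' hx.ne')
    fun t => mul_le_of_le_one_right (g.nonneg _) (inv_le_one_of_one_le₀ ?_)
  exact le_add_of_nonneg_right (sq_nonneg t)

theorem profile_nonneg (x : ℝ) : 0 ≤ g.profile x :=
  integral_nonneg fun _ => mul_nonneg (g.nonneg _) (by positivity)

theorem exists_profile_eq {c : ℝ} (hc : 0 < c) (hc' : c < Real.pi * g.dens 0) :
    ∃ x, 0 < x ∧ g.profile x = c := by
  have hsmall : g.profile c⁻¹ ≤ c := by simpa using g.profile_le (inv_pos.2 hc)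
  obtain ⟨x, hx, hxc⟩ := intermediate_value_Icc' (inv_pos.2 hc).le g.continuous_profile.continuousOn
    ⟨hsmall, g.profile_zero ▸ hc'.le⟩
  refine ⟨x, hx.1.lt_of_ne' ?_, hxc⟩
  rintro rfl
  exact hc'.ne' (g.profile_zero ▸ hxc)

theorem cauchyTransform_ofReal {x : ℝ} (hx : 0 < x) :
    cauchyTransform g.measure x = g.profile x := by
  have hreal : ((cauchyTransform g.measure x).re : ℂ) = cauchyTransform g.measure x :=
    Complex.conj_eq_iff_re.1 (by rw [← g.cauchyTransform_conj, Complex.conj_ofReal])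
  rw [← hreal, Complex.ofReal_inj, cauchyTransform, ← Complex.reCLM_apply,
    ← Complex.reCLM.integral_comp_comm (integrable_inv_sub_I_mul _ (by simpa using hx.ne')),
    g.integral_measure, ← mul_inv_cancel_left₀ hx.ne' (∫ _, _), ← abs_of_pos (inv_pos.2 hx),
    ← smul_eq_mul |x⁻¹|, ← Measure.integral_comp_mul_left, ← integral_const_mul, profile]
  congr with t
  have : 1 + t ^ 2 ≠ 0 := by positivity
  have : x ^ 2 + (x * t) ^ 2 ≠ 0 := by positivity
  simp only [Complex.reCLM_apply, inv_sub_I_mul_re, Complex.ofReal_re, Complex.ofReal_im, sub_zero,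
    smul_eq_mul]
  field_simp

end FreqDensity

/-! ### Multiplication by `iω` -/

section BoundedMultiplication

open scoped InnerProductSpace

variable {α : Type*} [MeasurableSpace α] {μ : Measure α} {φ : α → ℂ}

/-- Multiplication by an essentially bounded function, as a bounded operator on `L²(μ)`. -/
def boundedMul (φ : α → ℂ) (hφ : MemLp φ ∞ μ) : Lp ℂ 2 μ →L[ℂ] Lp ℂ 2 μ :=
  (ContinuousLinearMap.mul ℂ ℂ).holderL μ ∞ 2 2 hφ.toLp

theorem coeFn_boundedMul (hφ : MemLp φ ∞ μ) (f : Lp ℂ 2 μ) :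
    boundedMul φ hφ f =ᵐ[μ] fun x => φ x * f x := by
  filter_upwards [(ContinuousLinearMap.mul ℂ ℂ).coeFn_holder (r := 2) hφ.toLp f, hφ.coeFn_toLp]
    with x h hx
  rw [boundedMul, ContinuousLinearMap.holderL_apply_apply, h, hx, ContinuousLinearMap.mul_apply']

theorem adjoint_boundedMul (hφ : MemLp φ ∞ μ) :
    (boundedMul φ hφ).adjoint = boundedMul (star φ) hφ.star := by
  refine (ContinuousLinearMap.ext fun f => ext_inner_left ℂ fun h => ?_)
  rw [ContinuousLinearMap.adjoint_inner_right, L2.inner_def, L2.inner_def]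
  refine integral_congr_ae ?_
  filter_upwards [coeFn_boundedMul hφ h, coeFn_boundedMul hφ.star f] with x hh hf
  rw [hh, hf]
  simp only [RCLike.inner_apply, map_mul, Pi.star_apply, RCLike.star_def]
  ring

theorem injective_boundedMul (hφ : MemLp φ ∞ μ) (h0 : ∀ᵐ x ∂μ, φ x ≠ 0) :
    Function.Injective (boundedMul φ hφ) := by
  refine (injective_iff_map_eq_zero _).2 fun f hf => Lp.eq_zero_iff_ae_eq_zero.2 ?_
  filter_upwards [coeFn_boundedMul hφ f, Lp.eq_zero_iff_ae_eq_zero.1 hf, h0] with x hx hx' h0x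
  exact (mul_eq_zero.1 (hx.symm.trans hx')).resolve_left h0x

end BoundedMultiplication

section MulOp

open scoped ComplexConjugate LinearPMap

variable {g : FreqDensity} {z : ℂ}

/-- The set `i supp(g)` on the imaginary axis. -/
def FreqDensity.axisSupport (g : FreqDensity) : Set ℂ :=
  {z | ∃ ω ∈ tsupport g.dens, z = Complex.I * (ω : ℂ)}

theorem re_eq_zero_of_mem_axisSupport (hz : z ∈ g.axisSupport) : z.re = 0 := by
  obtain ⟨ω, -, rfl⟩ := hz
  simp

theorem mem_graph_mulOp_iff {v u : L2X g} :
    (v, u) ∈ (mulOp g).graph ↔ ∀ᵐ p ∂g.measureX, u p = Complex.I * p.1 * v p := by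
  rw [LinearPMap.mem_graph_iff]
  constructor
  · rintro ⟨w, rfl, rfl⟩
    exact (memLp_of_mem_mulDomain w.2).coeFn_toLp
  · intro h
    have hv : MemLp (fun p => Complex.I * (p.1 : ℂ) * v p) 2 g.measureX := (Lp.memLp u).ae_eq h
    exact ⟨⟨v, hv⟩, rfl, Lp.ext (hv.coeFn_toLp.trans (h.mono fun p hp => hp.symm))⟩

theorem ae_I_mul_sub_ne_zero (g : FreqDensity) (z : ℂ) :
    ∀ᵐ p ∂g.measureX, Complex.I * p.1 - z ≠ 0 := by
  refine Measure.quasiMeasurePreserving_fst.ae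
    (p := fun ω : ℝ => Complex.I * ω - z ≠ 0) ?_
  filter_upwards [compl_mem_ae_iff.2 (measure_singleton (μ := g.measure) z.im)] with ω hω h
  exact hω (by simpa [sub_eq_zero] using congrArg Complex.im h)

theorem isResolvent_mulOp
    (hz : MemLp (fun p : ℝ × I => (Complex.I * p.1 - z)⁻¹) ∞ g.measureX) :
    IsResolvent (mulOp g) z (boundedMul _ hz) := fun v u => by
  rw [mem_graph_mulOp_iff, Lp.ext_iff]
  refine Filter.eventually_congr ?_
  filter_upwards [coeFn_boundedMul hz (u - z • v), Lp.coeFn_sub u (z • v), Lp.coeFn_smul z v,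
    ae_I_mul_sub_ne_zero g z] with p h1 h2 h3 h4
  rw [h1, h2, Pi.sub_apply, h3, Pi.smul_apply, smul_eq_mul, inv_mul_eq_iff_eq_mul₀ h4, sub_mul,
    sub_left_inj]

theorem memLp_inv_I_mul_sub {ε : ℝ} (hε : 0 < ε)
    (hz : ∀ᵐ ω : ℝ ∂g.measure, ε ≤ ‖Complex.I * ω - z‖) :
    MemLp (fun p : ℝ × I => (Complex.I * p.1 - z)⁻¹) ∞ g.measureX := by
  refine memLp_top_of_bound (by fun_prop) ε⁻¹ ?_
  filter_upwards [Measure.quasiMeasurePreserving_fst.ae hz] with p hp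
  rw [norm_inv]
  exact inv_anti₀ hε hp

theorem memLp_inv_I_mul_sub_of_re_ne_zero (hz : z.re ≠ 0) :
    MemLp (fun p : ℝ × I => (Complex.I * p.1 - z)⁻¹) ∞ g.measureX :=
  memLp_inv_I_mul_sub (abs_pos.2 hz) <| .of_forall fun ω => by
    simpa using Complex.abs_re_le_norm (Complex.I * ω - z)

theorem memLp_inv_I_mul_sub_of_notMem_axisSupport (hz : z ∉ g.axisSupport) :
    MemLp (fun p : ℝ × I => (Complex.I * p.1 - z)⁻¹) ∞ g.measureX := by
  by_cases hre : z.re = 0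
  · have hzi : z = Complex.I * z.im := by apply Complex.ext <;> simp [hre]
    have hτ : z.im ∈ (tsupport g.dens)ᶜ := fun h => hz ⟨z.im, h, hzi⟩
    obtain ⟨ε, hε, hball⟩ := Metric.isOpen_iff.1 (isClosed_tsupport g.dens).isOpen_compl _ hτ
    refine memLp_inv_I_mul_sub hε ?_
    filter_upwards [g.ae_mem_tsupport] with ω hω
    by_contra! hlt
    refine hball ?_ hω
    rwa [hzi, ← mul_sub, norm_mul, Complex.norm_I, one_mul, ← Complex.ofReal_sub,
      Complex.norm_real] at hlt
  · exact memLp_inv_I_mul_sub_of_re_ne_zero hre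

theorem exists_approximate_eigenvector_mulOp {τ ε : ℝ} (hτ : τ ∈ tsupport g.dens) (hε : 0 < ε) :
    ∃ v w : L2X g, v ≠ 0 ∧ (v, w + (Complex.I * τ) • v) ∈ (mulOp g).graph ∧ ‖w‖ ≤ ε * ‖v‖ := by
  have hs : MeasurableSet (Metric.ball τ ε ×ˢ (univ : Set I)) :=
    Metric.isOpen_ball.measurableSet.prod .univ
  let v : L2X g := indicatorConstLp 2 hs (measure_ne_top _ _) 1
  have hv : v ≠ 0 := by
    have hpos := g.measure_pos_of_mem_tsupport hτ Metric.isOpen_ball (Metric.mem_ball_self hε)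
    simp [v, ← norm_ne_zero_iff, norm_indicatorConstLp, measureReal_def, Measure.prod_prod,
      ENNReal.toReal_eq_zero_iff, hpos.ne']
  have hvε : ∀ᵐ p ∂g.measureX, ‖(Complex.I * p.1 - Complex.I * τ) * v p‖ ≤ ε * ‖v p‖ := by
    filter_upwards [indicatorConstLp_coeFn (p := 2) (hs := hs) (hμs := measure_ne_top _ _)
      (c := (1 : ℂ))] with p hp
    by_cases hps : p ∈ Metric.ball τ ε ×ˢ (univ : Set I)
    · rw [norm_mul, ← mul_sub, norm_mul, Complex.norm_I, one_mul, ← Complex.ofReal_sub,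
        Complex.norm_real]
      gcongr
      exact (Metric.mem_ball.1 hps.1).le
    · simp [v, hp, hps]
  have hmem : MemLp (fun p => (Complex.I * p.1 - Complex.I * τ) * v p) 2 g.measureX :=
    (Lp.memLp v).of_le_mul (by fun_prop) hvε
  refine ⟨v, hmem.toLp, hv, mem_graph_mulOp_iff.2 ?_, Lp.norm_le_mul_norm_of_ae_le_mul ?_⟩
  · filter_upwards [hmem.coeFn_toLp, Lp.coeFn_add hmem.toLp ((Complex.I * τ) • v),
      Lp.coeFn_smul (Complex.I * τ) v] with p h1 h2 h3
    rw [h2, Pi.add_apply, h1, h3, Pi.smul_apply, smul_eq_mul]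
    ring
  · filter_upwards [hmem.coeFn_toLp, hvε] with p h1 h2
    rwa [h1]

theorem I_mul_notMem_resolventSet_mulOp {τ : ℝ} (hτ : τ ∈ tsupport g.dens) :
    Complex.I * τ ∉ resolventSet (mulOp g) := by
  intro h
  obtain ⟨R, hR⟩ := mem_resolventSet_iff.1 h
  obtain ⟨v, w, hv, hgraph, hw⟩ :=
    exists_approximate_eigenvector_mulOp hτ (ε := (‖R‖ + 1)⁻¹) (by positivity)
  have hRw : R w = v := by simpa using (hR _ _).1 hgraph
  have hlt : ‖v‖ < ‖v‖ :=
    calc ‖v‖ = ‖R w‖ := by rw [hRw]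
      _ ≤ ‖R‖ * ((‖R‖ + 1)⁻¹ * ‖v‖) := R.le_opNorm_of_le hw
      _ = ‖R‖ / (‖R‖ + 1) * ‖v‖ := by ring
      _ < 1 * ‖v‖ := by
        gcongr
        exact (div_lt_one (by positivity)).2 (lt_add_one _)
      _ = ‖v‖ := one_mul _
  exact hlt.false

theorem resolventSet_mulOp (g : FreqDensity) : resolventSet (mulOp g) = g.axisSupportᶜ := by
  ext z
  refine ⟨?_, fun hz => mem_resolventSet_iff.2
    ⟨_, isResolvent_mulOp (memLp_inv_I_mul_sub_of_notMem_axisSupport hz)⟩⟩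
  rintro hz ⟨τ, hτ, rfl⟩
  exact I_mul_notMem_resolventSet_mulOp hτ hz

theorem pointSpectrum_mulOp (g : FreqDensity) : pointSpectrum (mulOp g) = ∅ := by
  refine eq_empty_of_forall_notMem fun z hz => ?_
  obtain ⟨v, hv, hgraph⟩ := mem_pointSpectrum_iff.1 hz
  refine hv (Lp.eq_zero_iff_ae_eq_zero.2 ?_)
  filter_upwards [mem_graph_mulOp_iff.1 hgraph, Lp.coeFn_smul z v, ae_I_mul_sub_ne_zero g z]
    with p h1 h2 h3
  rw [h2, Pi.smul_apply, smul_eq_mul, eq_comm, ← sub_eq_zero, ← sub_mul] at h1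
  exact (mul_eq_zero.1 h1).resolve_left h3

theorem isClosed_mulOp (g : FreqDensity) : (mulOp g).IsClosed :=
  (isResolvent_mulOp (memLp_inv_I_mul_sub_of_re_ne_zero (z := 1) (by simp))).isClosed

theorem dense_domain_mulOp (g : FreqDensity) : Dense ((mulOp g).domain : Set (L2X g)) := by
  have hmem := memLp_inv_I_mul_sub_of_re_ne_zero (g := g) (z := 1) (by simp)
  refine (isResolvent_mulOp hmem).dense_domain ?_
  rw [adjoint_boundedMul]
  refine injective_boundedMul _ ?_
  filter_upwards [ae_I_mul_sub_ne_zero g 1] with p hp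
  exact star_ne_zero.2 (inv_ne_zero hp)

theorem adjoint_mulOp (g : FreqDensity) : (mulOp g)† = -mulOp g := by
  have hpos := memLp_inv_I_mul_sub_of_re_ne_zero (g := g) (z := 1) (by simp)
  have hneg := memLp_inv_I_mul_sub_of_re_ne_zero (g := g) (z := -1) (by simp)
  have hadj : (boundedMul _ hpos).adjoint = -boundedMul _ hneg := by
    ext1 f
    rw [adjoint_boundedMul, neg_apply]
    refine Lp.ext ?_
    filter_upwards [coeFn_boundedMul hpos.star f, coeFn_boundedMul hneg f,
      Lp.coeFn_neg (boundedMul _ hneg f)] with p h1 h2 h3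
    rw [h1, h3, Pi.neg_apply, h2, ← neg_mul, ← inv_neg]
    simp [sub_eq_add_neg, add_comm]
  have h := (isResolvent_mulOp hpos).adjoint (dense_domain_mulOp g)
  rw [hadj, map_one] at h
  exact h.eq (by simpa using (isResolvent_mulOp hneg).neg)

end MulOp

/-! ### The spectrum of `T` -/

section OpP

open scoped InnerProductSpace ComplexConjugate

variable {g : FreqDensity} {W : Graphon}

/-- The embedding `f ↦ f ∘ snd` of `L²(I)` into `L²(X, g dω dx)`. Its adjoint is the average
`z ↦ ∫ z(λ, ·) g(λ) dλ` over the frequencies. -/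
def liftX (g : FreqDensity) : Lp ℂ 2 (volume : Measure I) →L[ℂ] L2X g :=
  (Lp.compMeasurePreservingₗᵢ ℂ (Prod.snd : ℝ × I → I) measurePreserving_snd).toContinuousLinearMap

theorem coeFn_liftX (g : FreqDensity) (f : Lp ℂ 2 (volume : Measure I)) :
    liftX g f =ᵐ[g.measureX] fun p => f p.2 :=
  Lp.coeFn_compMeasurePreserving f measurePreserving_snd

theorem inner_liftX (f : Lp ℂ 2 (volume : Measure I)) (v : L2X g) :
    ⟪liftX g f, v⟫_ℂ = ∫ p, conj (f p.2) * v p ∂g.measureX := by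
  rw [L2.inner_def]
  refine integral_congr_ae ?_
  filter_upwards [coeFn_liftX g f] with p hp
  rw [hp, RCLike.inner_apply']

theorem adjoint_liftX_of_ae_eq {c : ℝ → ℂ} {b : Lp ℂ 2 (volume : Measure I)} {v : L2X g}
    (hv : v =ᵐ[g.measureX] fun p => c p.1 * b p.2) :
    (liftX g).adjoint v = (∫ ω, c ω ∂g.measure) • b := by
  refine ext_inner_left ℂ fun a => ?_
  calc ⟪a, (liftX g).adjoint v⟫_ℂ
      = ∫ p, conj (a p.2) * v p ∂g.measureX := by
        rw [ContinuousLinearMap.adjoint_inner_right, inner_liftX]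
    _ = ∫ p, c p.1 * (conj (a p.2) * b p.2) ∂g.measureX :=
        integral_congr_ae <| hv.mono fun p hp => by simp only [hp, mul_left_comm]
    _ = (∫ ω, c ω ∂g.measure) * ∫ x, conj (a x) * b x :=
        integral_prod_mul c fun x => conj (a x) * b x
    _ = ⟪a, (∫ ω, c ω ∂g.measure) • b⟫_ℂ := by
        simp only [inner_smul_right, L2.inner_def, RCLike.inner_apply']

theorem integral_mul_adjoint_liftX {k : I → ℂ} (hk : MemLp k 2 volume) (v : L2X g) :
    ∫ y, k y * (liftX g).adjoint v y = ∫ q, k q.2 * v q ∂g.measureX := by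
  have hstar := hk.star.coeFn_toLp
  calc ∫ y, k y * (liftX g).adjoint v y
      = ⟪hk.star.toLp, (liftX g).adjoint v⟫_ℂ := by
        rw [L2.inner_def]
        refine integral_congr_ae (hstar.mono fun y hy => ?_)
        simp [hy, RCLike.inner_apply', -RCLike.inner_apply]
    _ = ∫ q, k q.2 * v q ∂g.measureX := by
        rw [ContinuousLinearMap.adjoint_inner_right, inner_liftX]
        refine integral_congr_ae ?_
        filter_upwards [Measure.quasiMeasurePreserving_snd.ae hstar] with q hq
        simp [hq]

/-- The operator `𝒫` as a bounded operator: it averages over the frequencies, applies `𝒲`, and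
lifts the result to a function on `X`. -/
def clmP (g : FreqDensity) (W : Graphon) : L2X g →L[ℂ] L2X g :=
  liftX g ∘L W.clm ∘L (liftX g).adjoint

theorem clmP_apply (v : L2X g) : clmP g W v = liftX g (W.op ((liftX g).adjoint v)) :=
  congrArg (liftX g) (kernelCLM_apply W.memLp_complex _)

theorem opP_eq_clmP : opP g W = clmP g W := by
  refine LinearMap.ext fun v => Lp.ext ?_
  rw [ContinuousLinearMap.coe_coe, clmP_apply]
  set f := (liftX g).adjoint v with hf
  have hP : opP g W v =ᵐ[g.measureX] fun p => ∫ q, (W.kernel p.2 q.2 : ℂ) * v q ∂g.measureX :=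
    kernelOp_coeFn (W.memLp_X g) v
  filter_upwards [hP, coeFn_liftX g (W.op f),
    Measure.quasiMeasurePreserving_snd.ae (W.op_coeFn f),
    Measure.quasiMeasurePreserving_snd.ae (kernel_section_memLp W.memLp_complex)]
    with p h1 h2 h3 h4
  rw [h1, h2, h3, hf, integral_mul_adjoint_liftX h4]

theorem isCompactOperator_clmP : IsCompactOperator (clmP g W) :=
  ((isCompactOperator_kernelCLM W.memLp_complex).comp_clm (liftX g).adjoint).clm_comp (liftX g)

theorem adjoint_clmP : (clmP g W).adjoint = clmP g W := by
  have hW : W.clm.adjoint = W.clm := by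
    refine (ContinuousLinearMap.ext fun f => ext_inner_left ℂ fun h => ?_)
    rw [ContinuousLinearMap.adjoint_inner_right]
    exact (W.coe_clm ▸ W.isSymmetric_op : (W.clm : Module.End ℂ _).IsSymmetric) h f
  simp only [clmP, ContinuousLinearMap.adjoint_comp, ContinuousLinearMap.adjoint_adjoint, hW,
    ContinuousLinearMap.comp_assoc]

end OpP

section OpT

open scoped ComplexConjugate LinearPMap

variable {g : FreqDensity} {W : Graphon} {K : ℝ} {z : ℂ}

theorem opT_eq_vadd (g : FreqDensity) (W : Graphon) (K : ℝ) :
    opT g W K = (((K : ℂ) / 2) • clmP g W).toLinearMap +ᵥ mulOp g := by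
  refine LinearPMap.ext rfl fun v hv _ => ?_
  change mulOp g ⟨v, hv⟩ + ((K : ℂ) / 2) • opP g W v =
    ((K : ℂ) / 2) • clmP g W v + mulOp g ⟨v, hv⟩
  rw [opP_eq_clmP, add_comm, ContinuousLinearMap.coe_coe]

theorem mulOp_eq_vadd (g : FreqDensity) (W : Graphon) (K : ℝ) :
    mulOp g = (-(((K : ℂ) / 2) • clmP g W)).toLinearMap +ᵥ opT g W K := by
  rw [opT_eq_vadd, vadd_vadd, ContinuousLinearMap.toLinearMap_neg, neg_add_cancel, zero_vadd]

theorem mem_graph_opT_iff {v u : L2X g} :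
    (v, u) ∈ (opT g W K).graph ↔ (v, u - ((K : ℂ) / 2) • clmP g W v) ∈ (mulOp g).graph := by
  rw [opT_eq_vadd, mem_graph_vadd]
  rfl

theorem isClosed_opT : (opT g W K).IsClosed := by
  rw [opT_eq_vadd]
  exact isClosed_vadd (isClosed_mulOp g) _

theorem adjoint_opT : (opT g W K)† = -opT g W (-K) := by
  have hadj : (((K : ℂ) / 2) • clmP g W).adjoint = ((K : ℂ) / 2) • clmP g W := by
    rw [LinearIsometryEquiv.map_smulₛₗ, adjoint_clmP, map_div₀, Complex.conj_ofReal,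
      Complex.conj_ofNat]
  rw [opT_eq_vadd, adjoint_vadd (dense_domain_mulOp g), adjoint_mulOp, hadj]
  refine LinearPMap.eq_of_eq_graph (Submodule.ext fun ⟨v, u⟩ => ?_)
  rw [mem_graph_vadd, mem_graph_neg, mem_graph_neg, mem_graph_opT_iff]
  have hneg : -(u - ((K : ℂ) / 2) • clmP g W v) = -u - (((-K : ℝ) : ℂ) / 2) • clmP g W v := by
    rw [Complex.ofReal_neg, neg_div, neg_smul]
    abel
  rw [← hneg]
  rfl

theorem mem_resolventSet_opT_or_mem_pointSpectrum (hz : z ∉ g.axisSupport) :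
    z ∈ resolventSet (opT g W K) ∨ z ∈ pointSpectrum (opT g W K) := by
  rw [opT_eq_vadd]
  refine mem_resolventSet_or_mem_pointSpectrum_vadd (isCompactOperator_clmP.smul ((K : ℂ) / 2)) ?_
  rwa [resolventSet_mulOp]

theorem notMem_axisSupport_of_mem_resolventSet_opT (hz : z ∈ resolventSet (opT g W K)) :
    z ∉ g.axisSupport := by
  have h := mem_resolventSet_or_mem_pointSpectrum_vadd
    (B := -(((K : ℂ) / 2) • clmP g W)) (isCompactOperator_clmP.smul ((K : ℂ) / 2)).neg hz
  rwa [← mulOp_eq_vadd, pointSpectrum_mulOp, resolventSet_mulOp, mem_empty_iff_false, or_false]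
    at h

end OpT

section Eigenvalues

open scoped ComplexConjugate

variable {g : FreqDensity} {W : Graphon} {K : ℝ} {z : ℂ}

theorem ae_eq_of_mem_graph_mulOp {v : L2X g} {b : Lp ℂ 2 (volume : Measure I)}
    (h : (v, z • v - liftX g b) ∈ (mulOp g).graph) :
    v =ᵐ[g.measureX] fun p => (z - Complex.I * p.1)⁻¹ * b p.2 := by
  filter_upwards [mem_graph_mulOp_iff.1 h, Lp.coeFn_sub (z • v) (liftX g b), Lp.coeFn_smul z v,
    coeFn_liftX g b, ae_I_mul_sub_ne_zero g z] with p h1 h2 h3 h4 h5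
  rw [h2, Pi.sub_apply, h3, h4, Pi.smul_apply, smul_eq_mul] at h1
  rw [eq_inv_mul_iff_mul_eq₀ (by rwa [← neg_ne_zero, neg_sub])]
  linear_combination h1

theorem adjoint_liftX_of_mem_graph_mulOp {v : L2X g} {b : Lp ℂ 2 (volume : Measure I)}
    (h : (v, z • v - liftX g b) ∈ (mulOp g).graph) :
    (liftX g).adjoint v = cauchyTransform g.measure z • b :=
  adjoint_liftX_of_ae_eq (ae_eq_of_mem_graph_mulOp h)

theorem exists_hasEigenvalue_of_mem_pointSpectrum (hz : z ∈ pointSpectrum (opT g W K)) :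
    ∃ ζ, Module.End.HasEigenvalue W.op ζ ∧ (K : ℂ) / 2 * cauchyTransform g.measure z * ζ = 1 := by
  obtain ⟨v, hv, hgraph⟩ := mem_pointSpectrum_iff.1 hz
  rw [mem_graph_opT_iff, clmP_apply, ← map_smul] at hgraph
  set f := (liftX g).adjoint v with hf
  set c := (K : ℂ) / 2 * cauchyTransform g.measure z with hc
  have hfW : f = c • W.op f := by
    rw [hc, mul_comm, mul_smul]
    exact adjoint_liftX_of_mem_graph_mulOp hgraph
  have hf0 : f ≠ 0 := by
    intro h
    refine hv (Lp.eq_zero_iff_ae_eq_zero.2 ?_)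
    rw [h, map_zero, smul_zero] at hgraph
    filter_upwards [ae_eq_of_mem_graph_mulOp hgraph,
      Measure.quasiMeasurePreserving_snd.ae (Lp.coeFn_zero ℂ 2 (volume : Measure I))] with p h1 h2
    rw [h1, h2, Pi.zero_apply, mul_zero, Pi.zero_apply]
  have hc0 : c ≠ 0 := by
    rintro h
    rw [h, zero_smul] at hfW
    exact hf0 hfW
  refine ⟨c⁻¹, Module.End.hasEigenvalue_of_hasEigenvector (x := f)
    ⟨Module.End.mem_eigenspace_iff.2 ?_, hf0⟩, mul_inv_cancel₀ hc0⟩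
  exact (eq_inv_smul_iff₀ hc0).2 hfW.symm

theorem mem_pointSpectrum_of_hasEigenvalue (hz : z.re ≠ 0) {ζ : ℂ}
    (hζ : Module.End.HasEigenvalue W.op ζ)
    (h : (K : ℂ) / 2 * cauchyTransform g.measure z * ζ = 1) : z ∈ pointSpectrum (opT g W K) := by
  obtain ⟨f, hf⟩ := hζ.exists_hasEigenvector
  have hR := isResolvent_mulOp (g := g) (memLp_inv_I_mul_sub_of_re_ne_zero hz)
  set v := boundedMul _ _ (-liftX g f)
  have hgraph : (v, z • v - liftX g f) ∈ (mulOp g).graph := by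
    rw [hR, sub_right_comm, sub_self, zero_sub]
  have hmean := adjoint_liftX_of_mem_graph_mulOp hgraph
  refine mem_pointSpectrum_iff.2 ⟨v, fun hv0 => ?_, ?_⟩
  · rw [hv0, map_zero, eq_comm, smul_eq_zero_iff_left hf.2] at hmean
    simp [hmean] at h
  · rwa [mem_graph_opT_iff, clmP_apply, hmean, map_smul, hf.apply_eq_smul, smul_smul, map_smul,
      smul_smul, ← mul_assoc, h, one_smul]

theorem mem_pointSpectrum_opT_iff :
    z ∈ pointSpectrum (opT g W K) ↔ z.re ≠ 0 ∧ ∃ ζ : ℝ, Module.End.HasEigenvalue W.op (ζ : ℂ) ∧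
      (K : ℂ) / 2 * cauchyTransform g.measure z * ζ = 1 := by
  refine ⟨fun hz => ?_, fun ⟨hz, ζ, hζ, h⟩ => mem_pointSpectrum_of_hasEigenvalue hz hζ h⟩
  obtain ⟨_, hζ, h⟩ := exists_hasEigenvalue_of_mem_pointSpectrum hz
  obtain ⟨ζ, rfl⟩ := Graphon.exists_ofReal_eq_of_hasEigenvalue hζ
  refine ⟨fun hre => ?_, ζ, hζ, h⟩
  have hre' := re_cauchyTransform_eq_zero g.measure hre
  simpa [hre'] using congrArg Complex.re h

theorem im_eq_zero_of_mem_pointSpectrum_opT (hz : z ∈ pointSpectrum (opT g W K)) : z.im = 0 := by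
  obtain ⟨hre, ζ, -, h⟩ := mem_pointSpectrum_opT_iff.1 hz
  refine g.im_eq_zero_of_im_cauchyTransform_eq_zero hre ?_
  have hreal : cauchyTransform g.measure z = ((K / 2 * ζ)⁻¹ : ℝ) := by
    rw [mul_right_comm] at h
    rw [eq_inv_of_mul_eq_one_right h]
    push_cast
    rfl
  rw [hreal, Complex.ofReal_im]

theorem neg_conj_mem_pointSpectrum_opT_neg :
    -conj z ∈ pointSpectrum (opT g W (-K)) ↔ z ∈ pointSpectrum (opT g W K) := by
  simp only [mem_pointSpectrum_opT_iff, cauchyTransform_neg_conj]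
  refine and_congr (by simp) (exists_congr fun ζ => and_congr_right fun _ => ?_)
  rw [← (starRingEnd ℂ).injective.eq_iff]
  simp [neg_div, Complex.conj_ofNat]

theorem denseRange_shift_opT_iff :
    DenseRange (shift (opT g W K) z) ↔ Function.Injective (shift (opT g W K) z) := by
  rw [denseRange_shift_iff (A := opT g W K) (dense_domain_mulOp g), injective_shift_iff,
    adjoint_opT, ← neg_neg (conj z), neg_mem_pointSpectrum_neg, neg_conj_mem_pointSpectrum_opT_neg]

end Eigenvalues

section Spectrum

variable {g : FreqDensity} {W : Graphon} {K : ℝ}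

theorem residualSpectrum_opT : residualSpectrum (opT g W K) = ∅ :=
  eq_empty_of_forall_notMem fun _ hz => hz.2 (denseRange_shift_opT_iff.2 hz.1)

theorem continuousSpectrum_opT : continuousSpectrum (opT g W K) = g.axisSupport := by
  ext z
  constructor
  · rintro ⟨hspec, hinj, -⟩
    by_contra hz
    exact (mem_resolventSet_opT_or_mem_pointSpectrum hz).elim hspec (injective_shift_iff.1 hinj)
  · intro hz
    have hinj : Function.Injective (shift (opT g W K) z) := injective_shift_iff.2 fun h =>
      (mem_pointSpectrum_opT_iff.1 h).1 (re_eq_zero_of_mem_axisSupport hz)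
    exact ⟨fun h => notMem_axisSupport_of_mem_resolventSet_opT h hz, hinj,
      denseRange_shift_opT_iff.2 hinj⟩

theorem fullSpectrum_opT :
    fullSpectrum (opT g W K) = continuousSpectrum (opT g W K) ∪ pointSpectrum (opT g W K) := by
  refine Subset.antisymm (fun z hz => ?_) (union_subset (fun z hz => hz.1) fun z hz h =>
    notMem_pointSpectrum h hz)
  by_cases hax : z ∈ g.axisSupport
  · exact .inl (continuousSpectrum_opT.symm ▸ hax)
  · exact .inr ((mem_resolventSet_opT_or_mem_pointSpectrum hax).resolve_left hz)

end Spectrum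

section Threshold

variable {g : FreqDensity} {W : Graphon} {K : ℝ}

theorem ofReal_mem_pointSpectrum_opT_iff {x : ℝ} (hx : 0 < x) :
    (x : ℂ) ∈ pointSpectrum (opT g W K) ↔
      ∃ ζ : ℝ, Module.End.HasEigenvalue W.op (ζ : ℂ) ∧ K * ζ * g.profile x = 2 := by
  rw [mem_pointSpectrum_opT_iff, g.cauchyTransform_ofReal hx, Complex.ofReal_re,
    and_iff_right hx.ne']
  refine exists_congr fun ζ => and_congr_right fun _ => ?_
  norm_cast
  constructor <;> intro h <;> linarith

theorem le_KcPlus_iff :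
    (K : EReal) ≤ KcPlus g W ↔ ∀ ζ ∈ W.posEigs, K * ζ ≤ 2 / (Real.pi * g.dens 0) := by
  have hc : 0 ≤ 2 / (Real.pi * g.dens 0) := by have := g.dens_zero_pos; positivity
  by_cases hW : W.posEigs.Nonempty
  · have hmax := W.isGreatest_zetaMax hW
    rw [KcPlus, if_pos hW, EReal.coe_le_coe_iff, ← div_div, le_div_iff₀ hmax.1.1]
    refine ⟨fun h ζ hζ => ?_, fun h => h _ hmax.1⟩
    rcases le_total 0 K with hK | hK
    · exact (mul_le_mul_of_nonneg_left (hmax.2 hζ) hK).trans h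
    · exact (mul_nonpos_of_nonpos_of_nonneg hK hζ.1.le).trans hc
  · simp [KcPlus, not_nonempty_iff_eq_empty.1 hW]

theorem KcMinus_le_iff :
    KcMinus g W ≤ (K : EReal) ↔ ∀ ζ ∈ W.negEigs, K * ζ ≤ 2 / (Real.pi * g.dens 0) := by
  have hc : 0 ≤ 2 / (Real.pi * g.dens 0) := by have := g.dens_zero_pos; positivity
  by_cases hW : W.negEigs.Nonempty
  · have hmin := W.isLeast_zetaMin hW
    rw [KcMinus, if_pos hW, EReal.coe_le_coe_iff, ← div_div, div_le_iff_of_neg hmin.1.1]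
    refine ⟨fun h ζ hζ => ?_, fun h => h _ hmin.1⟩
    rcases le_total 0 K with hK | hK
    · exact (mul_nonpos_of_nonneg_of_nonpos hK hζ.1.le).trans hc
    · exact (mul_le_mul_of_nonpos_left (hmin.2 hζ) hK).trans h
  · simp [KcMinus, not_nonempty_iff_eq_empty.1 hW]

theorem KcMinus_le_and_le_KcPlus_iff :
    (KcMinus g W ≤ (K : EReal) ∧ (K : EReal) ≤ KcPlus g W) ↔
      ∀ ζ : ℝ, Module.End.HasEigenvalue W.op (ζ : ℂ) → K * ζ ≤ 2 / (Real.pi * g.dens 0) := by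
  rw [KcMinus_le_iff, le_KcPlus_iff]
  refine ⟨fun ⟨hneg, hpos⟩ ζ hζ => ?_, fun h => ⟨fun ζ hζ => h ζ hζ.2, fun ζ hζ => h ζ hζ.2⟩⟩
  rcases lt_trichotomy ζ 0 with h | rfl | h
  · exact hneg ζ ⟨h, hζ⟩
  · have := g.dens_zero_pos
    rw [mul_zero]
    positivity
  · exact hpos ζ ⟨h, hζ⟩

theorem eigenvalue_neg_of_subcritical
    (h : KcMinus g W ≤ (K : EReal) ∧ (K : EReal) ≤ KcPlus g W) {z : ℂ}
    (hz : z ∈ pointSpectrum (opT g W K)) : ∃ x : ℝ, x < 0 ∧ z = (x : ℂ) := by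
  have hreal : z = (z.re : ℂ) :=
    Complex.ext rfl (by rw [im_eq_zero_of_mem_pointSpectrum_opT hz, Complex.ofReal_im])
  have hre : z.re ≠ 0 := (mem_pointSpectrum_opT_iff.1 hz).1
  refine ⟨z.re, hre.lt_or_gt.resolve_right fun hpos => ?_, hreal⟩
  obtain ⟨ζ, hζ, heq⟩ := (ofReal_mem_pointSpectrum_opT_iff hpos).1 (hreal ▸ hz)
  have hg : 0 < Real.pi * g.dens 0 := mul_pos Real.pi_pos g.dens_zero_pos
  have hlt : (2 : ℝ) < 2 :=
    calc (2 : ℝ) = K * ζ * g.profile z.re := heq.symm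
      _ ≤ 2 / (Real.pi * g.dens 0) * g.profile z.re :=
        mul_le_mul_of_nonneg_right (KcMinus_le_and_le_KcPlus_iff.1 h ζ hζ) (g.profile_nonneg _)
      _ < 2 / (Real.pi * g.dens 0) * (Real.pi * g.dens 0) :=
        mul_lt_mul_of_pos_left (g.profile_lt hre) (by positivity)
      _ = 2 := div_mul_cancel₀ _ hg.ne'
  exact hlt.false

theorem exists_pos_eigenvalue_of_supercritical
    (h : ¬ (KcMinus g W ≤ (K : EReal) ∧ (K : EReal) ≤ KcPlus g W)) :
    ∃ x : ℝ, 0 < x ∧ (x : ℂ) ∈ pointSpectrum (opT g W K) := by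
  rw [KcMinus_le_and_le_KcPlus_iff] at h
  push Not at h
  obtain ⟨ζ, hζ, hlt⟩ := h
  have hg : 0 < Real.pi * g.dens 0 := mul_pos Real.pi_pos g.dens_zero_pos
  have hpos : 0 < K * ζ := lt_trans (by positivity) hlt
  obtain ⟨x, hx, hprofile⟩ := g.exists_profile_eq (c := 2 / (K * ζ)) (by positivity)
    ((div_lt_comm₀ hg hpos).1 hlt)
  refine ⟨x, hx, (ofReal_mem_pointSpectrum_opT_iff hx).2 ⟨ζ, hζ, ?_⟩⟩
  rw [hprofile, mul_div_cancel₀ _ hpos.ne']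

end Threshold

end KMGraph

end

theorem theorem3p1 (g : FreqDensity) (W : Graphon) :
    (W.posEigs.Nonempty → IsGreatest W.posEigs W.zetaMax) ∧
    (W.negEigs.Nonempty → IsLeast W.negEigs W.zetaMin) ∧
    ∀ K : ℝ,
      (opT g W K).IsClosed ∧
      residualSpectrum (opT g W K) = ∅ ∧
      continuousSpectrum (opT g W K) =
        {z : ℂ | ∃ ω ∈ tsupport g.dens, z = Complex.I * (ω : ℂ)} ∧
      ((KcMinus g W ≤ (K : EReal) ∧ (K : EReal) ≤ KcPlus g W) →
        fullSpectrum (opT g W K) =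
          continuousSpectrum (opT g W K) ∪ pointSpectrum (opT g W K) ∧
        ∀ z ∈ pointSpectrum (opT g W K), ∃ x : ℝ, x < 0 ∧ z = (x : ℂ)) ∧
      (¬ (KcMinus g W ≤ (K : EReal) ∧ (K : EReal) ≤ KcPlus g W) →
        ∃ x : ℝ, 0 < x ∧ (x : ℂ) ∈ pointSpectrum (opT g W K)) :=
  ⟨W.isGreatest_zetaMax, W.isLeast_zetaMin, fun _ =>
    ⟨isClosed_opT, residualSpectrum_opT, continuousSpectrum_opT,
      fun h => ⟨fullSpectrum_opT, fun _ hz => eigenvalue_neg_of_subcritical h hz⟩,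
      exists_pos_eigenvalue_of_supercritical⟩⟩
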